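/- **Proposition 6.1.** For $N\ge 1$ let $E_N\subset[0,1]$ be the set of irrational numbers $[a_1,a_2,\dots]$ all of whose continued fraction partial quotients satisfy $a_i\le N$, let $\delta_N=\dim_H(E_N)$, and let $\mathcal H^{\delta_N}$ be the $\delta_N$-dimensional Hausdorff measure. For a finite-index subgroup $G\subset \mathrm{PGL}(2,\mathbb Z)$ let $\mathbb P=\mathrm{PGL}(2,\mathbb Z)/G$ with the left action of $\mathrm{PGL}(2,\mathbb Z)$ (hence of $\mathrm{GL}(2,\mathbb Z)$), and let $\mathrm{Red}\subset \mathrm{GL}(2,\mathbb Z)$ be the set of all products $\begin{pmatrix}0&1\\1&a_1\end{pmatrix}\cdots\begin{pmatrix}0&1\\1&a_n\end{pmatrix}$ with $n\ge1$ and integers $a_i\ge 1$. Put $\mathbb D=\{z\in\mathbb C: |z-1|<3/2\}$ and let $V(\mathbb D\times\mathbb P)$ be the real Banach space (with the supremum norm) of functions on $\overline{\mathbb D}\times\mathbb P$ which on each sheet $\overline{\mathbb D}\times\{t\}$ are continuous, holomorphic in $\mathbb D$, and real at the real points. For $\sigma\in\mathbb R$ the truncated Gauss–Kuzmin operator on $V(\mathbb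 D\times\mathbb P)$ is $$(\mathcal L_{\sigma,N}f)(\beta,t)=\sum_{k=1}^N\frac{1}{(\beta+k)^{\sigma}}\,f\!\left(\frac1{\beta+k},\begin{pmatrix}0&1\\1&k\end{pmatrix}\cdot t\right).$$ An eigenfunction $f$ of $\mathcal L_{2\delta_N,N}$ is called normalized if $\int_{E_N\times\mathbb P}f\,d\mathcal H^{\delta_N}=\sum_{t\in\mathbb P}\int_{E_N}f(\beta,t)\,d\mathcal H^{\delta_N}(\beta)=1$. There is an $N_0$, independent of $G$, such that the following holds for every $N\ge N_0$. For $\mathbb P=\{1\}$ the operator $\mathcal L_{2\delta_N,N}$ on $V(\mathbb D)$ has a normalized eigenfunction $f_N(\beta)$ with eigenvalue $1$, and the eigenspace for the eigenvalue $1$ is $\mathbb R f_N$. Moreover, for every finite-index subgroup $G\subset \mathrm{PGL}(2,\mathbb Z)$ such that $\mathrm{Red}(t)=\mathbb P$ for each $t\in\mathbb P$, the operator $\mathcal L_{2\delta_N,N}$ on $V(\mathbb D\times\mathbb P)$ has a normalized eigenfunction $f_N(\beta,t)$ with eigenvalue $1$, the eigenspace for the eigenvalue $1$ is the line spanned by it,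 and $$f_N(\beta,t)=\frac{1}{|\mathbb P|}\,f_N(\beta)\qquad\text{for all }\beta\in\overline{\mathbb D},\ t\in\mathbb P.$$ -/

import Mathlib

open MeasureTheory Set
open scoped MatrixGroups

namespace GaussKuzmin

noncomputable section

/-! ## The group and its reduced matrices -/

/-- `PGL(2,ℤ) = GL(2,ℤ) / {±1}`; the centre of `GL(2,ℤ)` is `{±1}`. -/
abbrev PGL2Z : Type := GL (Fin 2) ℤ ⧸ Subgroup.center (GL (Fin 2) ℤ)

/-- The matrix `(0 1; 1 k)` as an element of `GL(2,ℤ)`. -/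
def redGen (k : ℤ) : GL (Fin 2) ℤ :=
  Matrix.GeneralLinearGroup.mk'' !![0, 1; 1, k] (by simp [Matrix.det_fin_two])

/-- The set `Red_n` of products of `n` matrices `(0 1; 1 a_i)` with integers `a_i ≥ 1`. -/
def RedN (n : ℕ) : Set (GL (Fin 2) ℤ) :=
  {g | ∃ a : Fin n → ℤ, (∀ i, 1 ≤ a i) ∧ g = (List.ofFn fun i => redGen (a i)).prod}

/-- The semigroup `Red = ⋃_{n ≥ 1} Red_n`. -/
def Red : Set (GL (Fin 2) ℤ) := ⋃ n ≥ 1, RedN n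

/-- The left action of a matrix in `GL(2,ℤ)` on a `PGL(2,ℤ)`-set. -/
def act {P : Type*} [MulAction PGL2Z P] (g : GL (Fin 2) ℤ) (t : P) : P :=
  (QuotientGroup.mk g : PGL2Z) • t

/-- The condition `Red(t) = P` for every `t ∈ P`. -/
def RedTransitive (P : Type*) [MulAction PGL2Z P] : Prop :=
  ∀ t : P, (fun g => act g t) '' Red = univ

/-! ## Continued fractions and the Cantor sets `E_N` -/

/-- The continued fraction shift `β ↦ 1/β - [1/β]`. -/
def gaussMap (β : ℝ) : ℝ := Int.fract (1 / β)

/-- The `n`-th partial quotient (counted from `n = 0`) of the continued fraction expansion of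
`β ∈ [0,1]`, that is `β = [a_1, a_2, …]` with `a_{n+1} = cfDigit β n`. -/
def cfDigit (β : ℝ) (n : ℕ) : ℤ := ⌊1 / gaussMap^[n] β⌋

/-- `E_N`: the numbers in `[0,1]` with an infinite continued fraction expansion (that is, the
irrational ones) all of whose partial quotients are at most `N`. -/
def cantorE (N : ℕ) : Set ℝ :=
  {β | β ∈ Icc (0 : ℝ) 1 ∧ Irrational β ∧ ∀ n, cfDigit β n ≤ N}

/-- `δ_N`, the Hausdorff dimension of `E_N`, as a real number. -/
def dimE (N : ℕ) : ℝ := (dimH (cantorE N)).toReal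

/-! ## The Banach space -/

/-- The open disc `|z - 1| < 3/2`. -/
def openDisc : Set ℂ := Metric.ball 1 (3 / 2)

/-- Its closure, the closed disc `|z - 1| ≤ 3/2`. -/
def closedDisc : Set ℂ := Metric.closedBall 1 (3 / 2)

instance : CompactSpace closedDisc :=
  isCompact_iff_compactSpace.mp (isCompact_closedBall (1 : ℂ) (3 / 2))

/-- A function on the closed disc, as a function on `ℂ` (zero outside the closed disc). -/
def onPlane (f : C(closedDisc, ℂ)) : ℂ → ℂ := Function.extend Subtype.val f 0

lemma onPlane_coe (f : C(closedDisc, ℂ)) (z : closedDisc) : onPlane f z = f z :=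
  Subtype.val_injective.extend_apply f 0 z

lemma onPlane_add (f g : C(closedDisc, ℂ)) : onPlane (f + g) = onPlane f + onPlane g := by
  funext z
  by_cases hz : z ∈ closedDisc
  · lift z to closedDisc using hz
    simp [onPlane_coe]
  · have h : ¬ ∃ a : closedDisc, (a : ℂ) = z := fun ⟨a, ha⟩ => hz (ha ▸ a.2)
    simp [onPlane, Function.extend_apply' _ _ _ h]

lemma onPlane_smul (c : ℝ) (f : C(closedDisc, ℂ)) : onPlane (c • f) = c • onPlane f := by
  funext z
  by_cases hz : z ∈ closedDisc
  · lift z to closedDisc using hz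
    simp [onPlane_coe]
  · have h : ¬ ∃ a : closedDisc, (a : ℂ) = z := fun ⟨a, ha⟩ => hz (ha ▸ a.2)
    simp [onPlane, Function.extend_apply' _ _ _ h]

lemma continuousOn_onPlane (f : C(closedDisc, ℂ)) : ContinuousOn (onPlane f) closedDisc := by
  rw [continuousOn_iff_continuous_domRestrict]
  have : closedDisc.domRestrict (onPlane f) = f := funext fun z => onPlane_coe f z
  rw [this]
  exact f.continuous

/-- The real Banach space `V(𝔻 × P)`, for `𝔻` the disc `|z - 1| < 3/2`: families, indexed by the
sheets `t ∈ P`, of continuous functions on the closed disc that are holomorphic in the open disc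
and real at the real points. For finite `P` it carries the supremum norm. -/
def V (P : Type*) : Submodule ℝ (P → C(closedDisc, ℂ)) where
  carrier := {f | ∀ t, DifferentiableOn ℂ (onPlane (f t)) openDisc ∧
    ∀ z : closedDisc, (z : ℂ).im = 0 → (f t z).im = 0}
  add_mem' {f g} hf hg t := by
    refine ⟨?_, fun z hz => ?_⟩
    · rw [Pi.add_apply, onPlane_add]
      exact (hf t).1.add (hg t).1
    · simp [(hf t).2 z hz, (hg t).2 z hz]
  zero_mem' t := by
    refine ⟨?_, fun z _ => by simp⟩
    have : onPlane ((0 : P → C(closedDisc, ℂ)) t) = 0 := by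
      simpa using onPlane_smul 0 (0 : C(closedDisc, ℂ))
    rw [this]
    exact differentiableOn_const 0
  smul_mem' c f hf t := by
    refine ⟨?_, fun z hz => ?_⟩
    · rw [Pi.smul_apply, onPlane_smul]
      exact (hf t).1.const_smul c
    · simp [(hf t).2 z hz]

/-- The value `f(z,t)`. -/
def evalAt {P : Type*} (f : V P) (z : ℂ) (t : P) : ℂ := onPlane (f.1 t) z

/-! ## The truncated Gauss–Kuzmin operator -/

lemma re_add_pos {z : ℂ} (hz : z ∈ closedDisc) {k : ℕ} (hk : 1 ≤ k) : 1 / 2 ≤ (z + k).re := by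
  have h1 : ‖z - 1‖ ≤ 3 / 2 := by simpa [closedDisc, dist_eq_norm] using hz
  have h2 := (abs_le.mp (Complex.abs_re_le_norm (z - 1))).1
  have hk' : (1 : ℝ) ≤ k := by exact_mod_cast hk
  simp at h2 ⊢
  linarith

lemma inv_mem_openDisc {w : ℂ} (hw : 1 / 2 ≤ w.re) : 1 / w ∈ openDisc := by
  have hw0 : w ≠ 0 := by
    rintro rfl
    norm_num at hw
  have hpos : 0 < ‖w‖ := norm_pos_iff.mpr hw0
  have hle : ‖1 - w‖ ≤ ‖w‖ := by
    rw [← sq_le_sq₀ (norm_nonneg _) (norm_nonneg _), ← Complex.normSq_eq_norm_sq,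
      ← Complex.normSq_eq_norm_sq, Complex.normSq_apply, Complex.normSq_apply]
    simp
    nlinarith
  have : 1 / w - 1 = (1 - w) / w := by field_simp
  rw [openDisc, Metric.mem_ball, dist_eq_norm, this, norm_div]
  have : ‖1 - w‖ / ‖w‖ ≤ 1 := (div_le_one hpos).mpr hle
  linarith

lemma openDisc_subset : openDisc ⊆ closedDisc := Metric.ball_subset_closedBall

/-- The expression `∑_{k=1}^N (z + k)^(-σ) f(1/(z + k), (0 1; 1 k)·t)`. -/
def truncSum {P : Type*} [MulAction PGL2Z P] (σ : ℝ) (N : ℕ) (f : V P) (z : ℂ) (t : P) : ℂ :=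
  ∑ k ∈ Finset.Icc 1 N, 1 / (z + k) ^ (σ : ℂ) * evalAt f (1 / (z + k)) (act (redGen k) t)

lemma slit {z : ℂ} (hz : z ∈ closedDisc) {k : ℕ} (hk : 1 ≤ k) : z + k ∈ Complex.slitPlane :=
  Or.inl (by linarith [re_add_pos hz hk])

lemma add_ne_zero' {z : ℂ} (hz : z ∈ closedDisc) {k : ℕ} (hk : 1 ≤ k) : z + k ≠ 0 :=
  Complex.slitPlane_ne_zero (slit hz hk)

lemma continuousOn_truncSum {P : Type*} [MulAction PGL2Z P] (σ : ℝ) (N : ℕ) (f : V P) (t : P) :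
    ContinuousOn (fun z => truncSum σ N f z t) closedDisc := by
  refine continuousOn_finsetSum _ fun k hk => ?_
  have hk := (Finset.mem_Icc.mp hk).1
  have hadd : ContinuousOn (fun z : ℂ => z + k) closedDisc := by fun_prop
  refine ContinuousOn.mul ?_ ?_
  · refine continuousOn_const.div (hadd.cpow_const fun z hz => slit hz hk) fun z hz => ?_
    simp [Complex.cpow_eq_zero_iff, add_ne_zero' hz hk]
  · exact (continuousOn_onPlane _).comp
      (continuousOn_const.div hadd fun z hz => add_ne_zero' hz hk)
      fun z hz => openDisc_subset (inv_mem_openDisc (re_add_pos hz hk))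

lemma differentiableOn_truncSum {P : Type*} [MulAction PGL2Z P] (σ : ℝ) (N : ℕ) (f : V P)
    (t : P) : DifferentiableOn ℂ (fun z => truncSum σ N f z t) openDisc := by
  refine DifferentiableOn.fun_sum fun k hk => ?_
  have hk := (Finset.mem_Icc.mp hk).1
  have hadd : DifferentiableOn ℂ (fun z : ℂ => z + k) openDisc := by fun_prop
  refine DifferentiableOn.mul ?_ ?_
  · refine (differentiableOn_const 1).div
      (hadd.cpow_const fun z hz => slit (openDisc_subset hz) hk) fun z hz => ?_
    simp [Complex.cpow_eq_zero_iff, add_ne_zero' (openDisc_subset hz) hk]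
  · exact (f.2 _).1.comp
      ((differentiableOn_const 1).div hadd fun z hz => add_ne_zero' (openDisc_subset hz) hk)
      fun z hz => inv_mem_openDisc (re_add_pos (openDisc_subset hz) hk)

lemma truncSum_im {P : Type*} [MulAction PGL2Z P] (σ : ℝ) (N : ℕ) (f : V P) (t : P) {z : ℂ}
    (hz : z ∈ closedDisc) (hr : z.im = 0) : (truncSum σ N f z t).im = 0 := by
  rw [truncSum, Complex.im_sum]
  refine Finset.sum_eq_zero fun k hk => ?_
  have hk := (Finset.mem_Icc.mp hk).1
  have hmem := openDisc_subset (inv_mem_openDisc (re_add_pos hz hk))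
  have hre := re_add_pos hz hk
  have hzk : z + k = (((z + k).re : ℝ) : ℂ) := Complex.ext (by simp) (by simp [hr])
  have h1 : (1 / (z + k) ^ (σ : ℂ)).im = 0 := by
    rw [hzk, ← Complex.ofReal_cpow (by linarith), ← Complex.ofReal_one, ← Complex.ofReal_div,
      Complex.ofReal_im]
  have h2 : (evalAt f (1 / (z + k)) (act (redGen k) t)).im = 0 := by
    have := (f.2 (act (redGen k) t)).2 ⟨1 / (z + k), hmem⟩ (by
      show (1 / (z + k)).im = 0
      rw [hzk, ← Complex.ofReal_one, ← Complex.ofReal_div, Complex.ofReal_im])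
    rwa [← onPlane_coe] at this
  rw [Complex.mul_im, h1, h2]
  ring

/-- `truncSum` as a family of continuous functions on the closed disc. -/
def truncFun {P : Type*} [MulAction PGL2Z P] (σ : ℝ) (N : ℕ) (f : V P) :
    P → C(closedDisc, ℂ) := fun t =>
  ⟨fun z => truncSum σ N f z t,
    continuousOn_iff_continuous_domRestrict.mp (continuousOn_truncSum σ N f t)⟩

/-- The truncated Gauss–Kuzmin operator `L_{σ,N}`,
`(L_{σ,N} f)(z,t) = ∑_{k=1}^N (z + k)^(-σ) f(1/(z + k), (0 1; 1 k)·t)`,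
as a linear operator on `V(𝔻 × P)`. -/
def truncGK (P : Type*) [MulAction PGL2Z P] (σ : ℝ) (N : ℕ) : Module.End ℝ (V P) where
  toFun f := ⟨truncFun σ N f, fun t => by
    refine ⟨(differentiableOn_truncSum σ N f t).congr fun z hz => ?_, fun z hz => ?_⟩
    · exact onPlane_coe (truncFun σ N f t) ⟨z, openDisc_subset hz⟩
    · exact truncSum_im σ N f t z.2 hz⟩
  map_add' f g := by
    refine Subtype.ext (funext fun t => ContinuousMap.ext fun z => ?_)
    show truncSum σ N (f + g) z t = truncSum σ N f z t + truncSum σ N g z t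
    simp only [truncSum, evalAt, Submodule.coe_add, Pi.add_apply, onPlane_add, mul_add,
      Finset.sum_add_distrib]
  map_smul' c f := by
    refine Subtype.ext (funext fun t => ContinuousMap.ext fun z => ?_)
    show truncSum σ N (c • f) z t = c • truncSum σ N f z t
    simp only [truncSum, evalAt, Submodule.coe_smul, Pi.smul_apply, onPlane_smul, mul_smul_comm,
      Finset.smul_sum]

/-! ## Normalized eigenfunctions -/

/-- The integral of `f` over `E_N × P` for the `δ_N`-dimensional Hausdorff measure, which on each
sheet `E_N × {t}` is that of `E_N ⊆ ℝ`. The values `f(β,t)` at real `β` are real. -/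
def mass {P : Type*} [Fintype P] (N : ℕ) (f : V P) : ℝ :=
  ∑ t : P, ∫ β in cantorE N, (evalAt f (β : ℂ) t).re ∂(Measure.hausdorffMeasure (dimE N))

/-- `f` is the unique normalized eigenfunction of `L_{2δ_N,N}` for the eigenvalue `1`: it is an
eigenfunction, every element of the eigenspace is a multiple of it, and it has integral `1`. -/
def IsUniqueNormalizedEigenfunction {P : Type*} [MulAction PGL2Z P] [Fintype P] (N : ℕ)
    (f : V P) : Prop :=
  (truncGK P (2 * dimE N) N).HasEigenvector 1 f ∧
    (truncGK P (2 * dimE N) N).eigenspace 1 = Submodule.span ℝ {f} ∧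
    mass N f = 1

end

end GaussKuzmin

/-! Everything is governed by the sums `partition N σ n` of `q ^ (-σ)` over the continuants `q` of
the words of length `n`. Continuants are multiplicative up to a factor 2, so these sums are
multiplicative in `n` up to `2 ^ σ`. For `N ≥ 2` there is therefore a critical `σ > 0` at which all
of them lie between `1` and `2 ^ σ` (`exists_critical`).

At this `σ` the Hausdorff measure of `E_N` in dimension `σ / 2` is finite, by the covers by images
of `[0, 1]` under words, and positive, by comparison with a limit measure on sequences. Hence `2 *
δ_N = σ` (`dimE_eq`). At the same `σ` the iterates of the operator on the constant `1` are bounded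
on the disc and bounded below on `[0, 1]`. The operator extends functions holomorphically to a
larger disc, hence is compact, and a limit of Cesàro means of the iterates is a fixed function `h`,
positive on `[0, 1]` (`exists_fixed`).

Uniqueness is a maximum principle (`fixed_eq_smul`). For a fixed `f` on `P` consider the ratio `f /
h` on `[0, 1] × P`. The functional equation carries a point where the maximum `M` is attained to all
its images under the letters, and two letters already make this set of points infinite. Some sheet
contains infinitely many of them, so `f = M h` there by the identity theorem, and the letters carry
this equality to every sheet they reach. They reach all sheets: on a finite set a semigroup of
permutations has the same orbits as the group it generates, and the matrices with partial quotients
1 and 2 generate all the others (`exists_actWord_eq`).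

The copy of `h` on every sheet is fixed, so it spans the eigenspace, and normalization over the
sheets produces the factor `1 / |P|`. -/

namespace GaussKuzmin

/-! ## Words, Möbius maps and continuants -/

section Words

variable {N : ℕ}

/-- The coefficients `((p, p'), (q, q'))` of the Möbius map `z ↦ (p + p' z) / (q + q' z)` attached
to a word in the letters `Fin N`, where the letter `i` stands for the partial quotient `i + 1`. -/
def mob : List (Fin N) → (ℕ × ℕ) × (ℕ × ℕ)
  | [] => ((0, 1), (1, 0))
  | i :: w => ((mob w).2, ((mob w).1.1 + (i + 1) * (mob w).2.1,
      (mob w).1.2 + (i + 1) * (mob w).2.2))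

/-- The continuant of a word. -/
def cont (w : List (Fin N)) : ℕ := (mob w).2.1

/-- The inequality for the sums makes the induction close: `q' ≤ q` for a longer word needs it,
while `p' ≤ p` alone fails for the empty word. -/
lemma mob_bounds (w : List (Fin N)) :
    (mob w).1.2 + (mob w).2.2 ≤ (mob w).1.1 + (mob w).2.1 ∧ (mob w).2.2 ≤ (mob w).2.1 ∧
      (mob w).1.1 ≤ (mob w).2.1 ∧ 1 ≤ (mob w).2.1 := by
  induction w with
  | nil => simp [mob]
  | cons i w ih =>
    obtain ⟨h1, h2, h3, h4⟩ := ih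
    simp only [mob]
    have h5 : (i : ℕ) * (mob w).2.2 ≤ (i : ℕ) * (mob w).2.1 := Nat.mul_le_mul_left _ h2
    have h6 : 0 ≤ (i : ℕ) * (mob w).2.1 := Nat.zero_le _
    simp only [add_mul, one_mul]
    omega

lemma cont_pos (w : List (Fin N)) : 0 < cont w := (mob_bounds w).2.2.2

lemma cont_pos' (w : List (Fin N)) : (0 : ℝ) < cont w := by exact_mod_cast cont_pos w

lemma one_le_cont (w : List (Fin N)) : (1 : ℝ) ≤ cont w := by exact_mod_cast cont_pos w

/-- All partial quotients are at least 1, so the word of ones is the worst case. The bound on `p` is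
carried along because the new `q` is at least `p + q`. -/
lemma fib_le_cont (w : List (Fin N)) :
    Nat.fib w.length ≤ (mob w).1.1 ∧ Nat.fib (w.length + 1) ≤ cont w := by
  induction w with
  | nil => simp [mob, cont]
  | cons i w ih =>
    obtain ⟨h1, h2⟩ := ih
    simp only [cont, mob, List.length_cons] at *
    refine ⟨h2, ?_⟩
    rw [Nat.fib_add_two]
    have h6 : 0 ≤ (i : ℕ) * (mob w).2.1 := Nat.zero_le _
    simp only [add_mul, one_mul]
    omega

lemma length_le_cont (w : List (Fin N)) : w.length ≤ cont w := by
  have h := (fib_le_cont w).2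
  have := Nat.le_fib_add_one (w.length + 1)
  omega

lemma mob_append (u v : List (Fin N)) :
    mob (u ++ v) = (((mob u).1.1 * (mob v).2.1 + (mob u).1.2 * (mob v).1.1,
        (mob u).1.1 * (mob v).2.2 + (mob u).1.2 * (mob v).1.2),
      ((mob u).2.1 * (mob v).2.1 + (mob u).2.2 * (mob v).1.1,
        (mob u).2.1 * (mob v).2.2 + (mob u).2.2 * (mob v).1.2)) := by
  induction u with
  | nil => simp [mob]
  | cons i u ih =>
    simp only [List.cons_append, mob, ih, Prod.mk.injEq]
    refine ⟨trivial, ?_, ?_⟩ <;> ring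

/-- The continuant of `u ++ v` is `q_u q_v + q'_u p_v`. The second term is nonnegative, and at most
the first by `mob_bounds`; this gives both this bound and `cont_append_le`. -/
lemma cont_mul_le (u v : List (Fin N)) : cont u * cont v ≤ cont (u ++ v) := by
  simp only [cont, mob_append]
  exact Nat.le_add_right _ _

lemma cont_append_le (u v : List (Fin N)) : cont (u ++ v) ≤ 2 * (cont u * cont v) := by
  simp only [cont, mob_append]
  have := Nat.mul_le_mul (mob_bounds u).2.1 (mob_bounds v).2.2.1
  omega

/-- The denominator `q + q' z` of the Möbius map of a word. -/
def den {K : Type*} [Field K] (w : List (Fin N)) (z : K) : K := (mob w).2.1 + (mob w).2.2 * z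

/-- The Möbius map of a word. -/
def phi {K : Type*} [Field K] (w : List (Fin N)) (z : K) : K :=
  ((mob w).1.1 + (mob w).1.2 * z) / den w z

section Field

variable {K : Type*} [Field K]

@[simp] lemma den_nil (z : K) : den ([] : List (Fin N)) z = 1 := by simp [den, mob]

@[simp] lemma phi_nil (z : K) : phi ([] : List (Fin N)) z = z := by simp [phi, mob]

lemma den_cons (i : Fin N) (w : List (Fin N)) {z : K} (h : den w z ≠ 0) :
    den (i :: w) z = den w z * (phi w z + ((i + 1 : ℕ) : K)) := by
  rw [phi, mul_add, mul_div_cancel₀ _ h]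
  simp only [den, mob]
  push_cast
  ring

lemma phi_cons (i : Fin N) (w : List (Fin N)) {z : K} (h : den w z ≠ 0) :
    phi (i :: w) z = 1 / (phi w z + ((i + 1 : ℕ) : K)) := by
  have : phi (i :: w) z = den w z / den (i :: w) z := rfl
  rw [this, den_cons i w h, div_mul_cancel_left₀ h, one_div]

lemma ofReal_den (w : List (Fin N)) (x : ℝ) : ((den w x : ℝ) : ℂ) = den w (x : ℂ) := by
  simp [den]

lemma ofReal_phi (w : List (Fin N)) (x : ℝ) : ((phi w x : ℝ) : ℂ) = phi w (x : ℂ) := by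
  simp [phi, ofReal_den]

end Field

/-! ### Distortion of the Möbius maps on the unit interval. -/

lemma cont_le_den (w : List (Fin N)) {x : ℝ} (hx : x ∈ Icc (0 : ℝ) 1) : (cont w : ℝ) ≤ den w x := by
  have : (0 : ℝ) ≤ (mob w).2.2 * x := mul_nonneg (Nat.cast_nonneg _) hx.1
  simp only [cont, den]
  linarith

lemma den_le_cont (w : List (Fin N)) {x : ℝ} (hx : x ∈ Icc (0 : ℝ) 1) :
    den w x ≤ 2 * cont w := by
  have h : ((mob w).2.2 : ℝ) ≤ (mob w).2.1 := by exact_mod_cast (mob_bounds w).2.1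
  have : ((mob w).2.2 : ℝ) * x ≤ (mob w).2.2 := mul_le_of_le_one_right (Nat.cast_nonneg _) hx.2
  simp only [cont, den]
  linarith

lemma den_pos (w : List (Fin N)) {x : ℝ} (hx : x ∈ Icc (0 : ℝ) 1) : 0 < den w x :=
  (cont_pos' w).trans_le (cont_le_den w hx)

lemma inv_add_mem_Icc {x : ℝ} (hx : x ∈ Icc (0 : ℝ) 1) (k : ℕ) :
    1 / (x + ((k + 1 : ℕ) : ℝ)) ∈ Icc (0 : ℝ) 1 := by
  have h0 := hx.1
  have hk : (0 : ℝ) ≤ k := Nat.cast_nonneg k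
  push_cast
  exact ⟨by positivity, by rw [div_le_one (by positivity)]; linarith⟩

lemma phi_mem_Icc (w : List (Fin N)) {x : ℝ} (hx : x ∈ Icc (0 : ℝ) 1) :
    phi w x ∈ Icc (0 : ℝ) 1 := by
  induction w with
  | nil => simpa using hx
  | cons i w ih =>
    rw [phi_cons i w (den_pos w hx).ne']
    exact inv_add_mem_Icc ih i

/-- This expresses that the determinant is `±1`. With `den` between `q` and `2q`, word images have
diameter comparable to `q ^ (-2)`, whence the exponent `σ / 2` later. -/
lemma abs_phi_sub (w : List (Fin N)) {x y : ℝ} (hx : x ∈ Icc (0 : ℝ) 1) (hy : y ∈ Icc (0 : ℝ) 1) :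
    |phi w x - phi w y| = |x - y| / (den w x * den w y) := by
  induction w with
  | nil => simp
  | cons i w ih =>
    have hx' := den_pos w hx
    have hy' := den_pos w hy
    have h1 := (phi_mem_Icc w hx).1
    have h2 := (phi_mem_Icc w hy).1
    have hi : (0 : ℝ) < ((i + 1 : ℕ) : ℝ) := by positivity
    rw [phi_cons i w hx'.ne', phi_cons i w hy'.ne', den_cons i w hx'.ne', den_cons i w hy'.ne']
    have hA : 0 < phi w x + ((i + 1 : ℕ) : ℝ) := by linarith
    have hB : 0 < phi w y + ((i + 1 : ℕ) : ℝ) := by linarith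
    have : 1 / (phi w x + ((i + 1 : ℕ) : ℝ)) - 1 / (phi w y + ((i + 1 : ℕ) : ℝ)) =
        -(phi w x - phi w y) / ((phi w x + ((i + 1 : ℕ) : ℝ)) * (phi w y + ((i + 1 : ℕ) : ℝ))) := by
      rw [div_sub_div _ _ hA.ne' hB.ne']
      congr 1
      ring
    rw [this, abs_div, abs_neg, ih, abs_of_pos (mul_pos hA hB), div_div]
    congr 1
    ring

lemma abs_phi_sub_le (w : List (Fin N)) {x y : ℝ} (hx : x ∈ Icc (0 : ℝ) 1)
    (hy : y ∈ Icc (0 : ℝ) 1) : |phi w x - phi w y| ≤ 1 / (cont w : ℝ) ^ 2 := by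
  have hq := cont_pos' w
  rw [abs_phi_sub w hx hy]
  have h1 : |x - y| ≤ 1 := by
    rw [abs_le]; constructor <;> linarith [hx.1, hx.2, hy.1, hy.2]
  have h2 : (cont w : ℝ) ^ 2 ≤ den w x * den w y := by
    rw [sq]
    exact mul_le_mul (cont_le_den w hx) (cont_le_den w hy) hq.le (den_pos w hx).le
  exact div_le_div₀ zero_le_one h1 (by positivity) h2

lemma le_abs_phi_sub (w : List (Fin N)) {x y : ℝ} (hx : x ∈ Icc (0 : ℝ) 1)
    (hy : y ∈ Icc (0 : ℝ) 1) : |x - y| / (4 * (cont w : ℝ) ^ 2) ≤ |phi w x - phi w y| := by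
  rw [abs_phi_sub w hx hy]
  have h2 : den w x * den w y ≤ 4 * (cont w : ℝ) ^ 2 := by
    calc den w x * den w y ≤ (2 * cont w) * (2 * cont w) :=
          mul_le_mul (den_le_cont w hx) (den_le_cont w hy) (den_pos w hy).le (by positivity)
      _ = _ := by ring
  exact div_le_div_of_nonneg_left (abs_nonneg _) (mul_pos (den_pos w hx) (den_pos w hy)) h2

lemma phi_injOn (w : List (Fin N)) : InjOn (phi w : ℝ → ℝ) (Icc 0 1) := by
  intro x hx y hy h
  have h1 := le_abs_phi_sub w hx hy
  rw [h, sub_self, abs_zero] at h1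
  by_contra hne
  have : 0 < |x - y| / (4 * (cont w : ℝ) ^ 2) :=
    div_pos (abs_pos.mpr (sub_ne_zero.mpr hne)) (by have := cont_pos' w; positivity)
  linarith

lemma continuousOn_phi (w : List (Fin N)) : ContinuousOn (phi w : ℝ → ℝ) (Icc 0 1) := by
  refine ContinuousOn.div (by fun_prop) ?_ fun x hx => (den_pos w hx).ne'
  unfold den
  fun_prop

/-! ## Sums over words -/

/-- The sum of `F` over the words of length `n`. -/
def wordSum {M : Type*} [AddCommMonoid M] (N n : ℕ) (F : List (Fin N) → M) : M :=
  ∑ f : Fin n → Fin N, F (List.ofFn f)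

section WordSum

variable {M : Type*} [AddCommMonoid M]

@[simp] lemma wordSum_zero (F : List (Fin N) → M) : wordSum N 0 F = F [] := by
  simp [wordSum]

lemma wordSum_succ (n : ℕ) (F : List (Fin N) → M) :
    wordSum N (n + 1) F = ∑ i, wordSum N n fun w => F (i :: w) := by
  simp only [wordSum]
  rw [← Fintype.sum_prod_type']
  refine (Fintype.sum_equiv (Fin.consEquiv fun _ : Fin (n + 1) => Fin N) _ _ fun x => ?_).symm
  simp [Fin.consEquiv, List.ofFn_succ]

lemma wordSum_succ' (n : ℕ) (F : List (Fin N) → M) :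
    wordSum N (n + 1) F = wordSum N n fun w => ∑ i, F (i :: w) := by
  rw [wordSum_succ]
  exact Finset.sum_comm

lemma wordSum_add (m n : ℕ) (F : List (Fin N) → M) :
    wordSum N (m + n) F = wordSum N m fun u => wordSum N n fun v => F (u ++ v) := by
  induction m generalizing F with
  | zero => simp
  | succ m ih =>
    rw [Nat.add_right_comm, wordSum_succ, wordSum_succ]
    exact Finset.sum_congr rfl fun i _ => ih _

end WordSum

/-! ## The partition function and the critical exponent -/

/-- The sum of `q ^ (-σ)` over the continuants `q` of the words of length `n`. -/
noncomputable def partition (N : ℕ) (σ : ℝ) (n : ℕ) : ℝ :=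
  wordSum N n fun w => (cont w : ℝ) ^ (-σ)

lemma partition_pos [NeZero N] (σ : ℝ) (n : ℕ) : 0 < partition N σ n :=
  Finset.sum_pos (fun _ _ => Real.rpow_pos_of_pos (cont_pos' _) _) Finset.univ_nonempty

lemma partition_add_le {σ : ℝ} (hσ : 0 ≤ σ) (m n : ℕ) :
    partition N σ (m + n) ≤ partition N σ m * partition N σ n := by
  simp only [partition, wordSum_add]
  simp only [wordSum, Finset.sum_mul_sum]
  refine Finset.sum_le_sum fun u _ => Finset.sum_le_sum fun v _ => ?_
  rw [← Real.mul_rpow (cont_pos' _).le (cont_pos' _).le]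
  refine Real.rpow_le_rpow_of_nonpos (mul_pos (cont_pos' _) (cont_pos' _)) ?_ (by linarith)
  exact_mod_cast cont_mul_le _ _

lemma le_partition_add {σ : ℝ} (hσ : 0 ≤ σ) (m n : ℕ) :
    2 ^ (-σ) * (partition N σ m * partition N σ n) ≤ partition N σ (m + n) := by
  simp only [partition, wordSum_add]
  simp only [wordSum, Finset.sum_mul_sum]
  simp only [Finset.mul_sum]
  refine Finset.sum_le_sum fun u _ => Finset.sum_le_sum fun v _ => ?_
  rw [← Real.mul_rpow (cont_pos' _).le (cont_pos' _).le,
    ← Real.mul_rpow zero_le_two (mul_pos (cont_pos' _) (cont_pos' _)).le]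
  refine Real.rpow_le_rpow_of_nonpos (cont_pos' _) ?_ (by linarith)
  exact_mod_cast cont_append_le _ _

lemma partition_mul_le [NeZero N] {σ : ℝ} (hσ : 0 ≤ σ) (m n : ℕ) :
    partition N σ (m * n) ≤ partition N σ m ^ n := by
  induction n with
  | zero => simp [partition, cont, mob]
  | succ n ih =>
    rw [Nat.mul_succ, pow_succ]
    exact (partition_add_le hσ _ _).trans (mul_le_mul_of_nonneg_right ih (partition_pos _ _).le)

lemma le_partition_mul [NeZero N] {σ : ℝ} (hσ : 0 ≤ σ) (m n : ℕ) :
    (2 ^ (-σ) * partition N σ m) ^ n ≤ partition N σ (m * n) := by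
  induction n with
  | zero => simp [partition, cont, mob]
  | succ n ih =>
    rw [Nat.mul_succ, pow_succ]
    refine le_trans ?_ (le_partition_add hσ _ _)
    have := mul_le_mul_of_nonneg_right ih
      (mul_nonneg (Real.rpow_nonneg zero_le_two (-σ)) (partition_pos (N := N) σ m).le)
    linarith

lemma partition_antitone (n : ℕ) : Antitone fun σ => partition N σ n := fun _ _ h =>
  Finset.sum_le_sum fun _ _ => Real.rpow_le_rpow_of_exponent_le (one_le_cont _) (neg_le_neg h)

lemma continuous_partition (n : ℕ) : Continuous fun σ => partition N σ n := by
  refine continuous_finsetSum _ fun f _ => ?_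
  exact Continuous.rpow continuous_const continuous_neg fun _ => Or.inl (cont_pos' _).ne'

lemma partition_zero (n : ℕ) : partition N 0 n = (N : ℝ) ^ n := by
  simp [partition, wordSum]

lemma two_le_cont {w : List (Fin N)} (hw : w.length = 2) : 2 ≤ cont w := by
  have := (fib_le_cont w).2
  rw [hw] at this
  exact this

/-- Length 2 is needed because the one-letter word with partial quotient 1 has continuant 1,
whatever `σ` is. -/
lemma exists_partition_lt_one (N : ℕ) : ∃ σ : ℝ, 0 ≤ σ ∧ partition N σ 2 < 1 := by
  obtain ⟨k, hk⟩ := pow_unbounded_of_one_lt ((N : ℝ) ^ 2) one_lt_two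
  refine ⟨k, Nat.cast_nonneg k, ?_⟩
  have h : partition N (k : ℝ) 2 ≤ ∑ _f : Fin 2 → Fin N, (2 : ℝ) ^ (-(k : ℝ)) := by
    refine Finset.sum_le_sum fun f _ => ?_
    refine Real.rpow_le_rpow_of_nonpos zero_lt_two ?_ (by simp)
    exact_mod_cast two_le_cont (List.length_ofFn)
  refine h.trans_lt ?_
  rw [Finset.sum_const, Finset.card_univ, Fintype.card_fun, Fintype.card_fin, Fintype.card_fin,
    nsmul_eq_mul, Real.rpow_neg zero_le_two, Real.rpow_natCast, ← div_eq_mul_inv,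
    div_lt_one (by positivity)]
  exact_mod_cast hk

/-- At the critical exponent the partition functions are bounded above and below. -/
lemma exists_critical (hN : 2 ≤ N) :
    ∃ σ : ℝ, 0 < σ ∧ ∀ n, 1 ≤ partition N σ n ∧ partition N σ n ≤ 2 ^ σ := by
  have : NeZero N := ⟨by omega⟩
  set A : Set ℝ := {σ | 0 ≤ σ ∧ ∃ n, partition N σ n < 1} with hA
  have hAne : A.Nonempty := by
    obtain ⟨σ, h0, h1⟩ := exists_partition_lt_one N
    exact ⟨σ, h0, 2, h1⟩
  have hbdd : BddBelow A := ⟨0, fun x hx => hx.1⟩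
  set s := sInf A with hs
  have hs0 : 0 ≤ s := le_csInf hAne fun x hx => hx.1
  have hup : ∀ x, s < x → x ∈ A := fun x hx => by
    obtain ⟨y, ⟨hy0, n, hn⟩, hyx⟩ := (csInf_lt_iff hbdd hAne).mp hx
    exact ⟨hy0.trans hyx.le, n, (partition_antitone n hyx.le).trans_lt hn⟩
  -- A value below 1 would persist slightly to the left of `s`, against the infimum. There is room
  -- to the left because at exponent `0` the sum is `N ^ n ≥ 1`.
  have hge : ∀ n, 1 ≤ partition N s n := by
    intro n
    by_contra! h
    have hspos : 0 < s := by
      rcases hs0.eq_or_lt with h0 | h0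
      · rw [← h0, partition_zero] at h
        have : (1 : ℝ) ≤ (N : ℝ) ^ n := one_le_pow₀ (by exact_mod_cast (by omega : 1 ≤ N))
        linarith
      · exact h0
    have hev := ((continuous_partition (N := N) n).tendsto s).eventually_lt_const h
    obtain ⟨x, hx, hxs⟩ := ((hev.filter_mono nhdsWithin_le_nhds).and
      (Ioo_mem_nhdsLT hspos)).exists
    exact absurd (csInf_le hbdd ⟨hxs.1.le, n, hx⟩) (not_le.mpr hxs.2)
  -- If this fails for `m`, then at some `x > s` still `2 ^ (-x) * partition N x m > 1`, while some
  -- `partition N x n < 1`. The two kinds of multiplicativity then put `partition N x (m * n)` both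
  -- above and below 1.
  have hle : ∀ n, partition N s n ≤ 2 ^ s := by
    intro m
    by_contra! h
    have hc : Continuous fun σ : ℝ => (2 : ℝ) ^ (-σ) * partition N σ m :=
      (continuous_const.rpow continuous_neg fun _ => Or.inl two_ne_zero).mul
        (continuous_partition m)
    have h1 : 1 < (2 : ℝ) ^ (-s) * partition N s m := by
      have := mul_lt_mul_of_pos_left h (Real.rpow_pos_of_pos zero_lt_two (-s))
      rwa [← Real.rpow_add zero_lt_two, neg_add_cancel, Real.rpow_zero] at this
    have hev := (hc.tendsto s).eventually_const_lt h1
    obtain ⟨x, hx, hxs⟩ := ((hev.filter_mono nhdsWithin_le_nhds).and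
      (self_mem_nhdsWithin (s := Ioi s))).exists
    obtain ⟨hx0, n, hn⟩ := hup x hxs
    have e1 := one_le_pow₀ hx.le (n := n)
    have e2 := le_partition_mul (N := N) hx0 m n
    have e3 := partition_mul_le (N := N) hx0 n m
    rw [mul_comm n m] at e3
    rcases Nat.eq_zero_or_pos m with rfl | hm
    · have h2 : (2 : ℝ) ^ (-x) ≤ 1 := Real.rpow_le_one_of_one_le_of_nonpos one_le_two (by linarith)
      simp only [partition, wordSum_zero, cont, mob] at hx
      simp at hx
      linarith
    · have e4 := pow_lt_one₀ (partition_pos x n).le hn hm.ne'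
      linarith
  refine ⟨s, hs0.lt_of_ne fun h0 => ?_, fun n => ⟨hge n, hle n⟩⟩
  have := hle 1
  rw [← h0, partition_zero] at this
  have h2 : (2 : ℝ) ≤ N := by exact_mod_cast hN
  simp at this
  omega

end Words

/-! ## Iterates of the operator -/

section Operator

variable {N : ℕ}

lemma sum_Icc_eq_sum_fin {M : Type*} [AddCommMonoid M] (N : ℕ) (F : ℕ → M) :
    ∑ k ∈ Finset.Icc 1 N, F k = ∑ i : Fin N, F (i + 1) := by
  rw [Fin.sum_univ_eq_sum_range (fun i => F (i + 1)) N, Finset.range_eq_Ico,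
    Finset.sum_Ico_add' F 0 N 1]
  rfl

lemma ofReal_mem_openDisc {x : ℝ} (hx : x ∈ Icc (0 : ℝ) 1) : (x : ℂ) ∈ openDisc := by
  rw [openDisc, Metric.mem_ball, dist_eq_norm, ← Complex.ofReal_one, ← Complex.ofReal_sub,
    Complex.norm_real, Real.norm_eq_abs, abs_lt]
  constructor <;> linarith [hx.1, hx.2]

lemma ofReal_mem_closedDisc {x : ℝ} (hx : x ∈ Icc (0 : ℝ) 1) : (x : ℂ) ∈ closedDisc :=
  openDisc_subset (ofReal_mem_openDisc hx)

/-- On the disc `Re z ≥ -1/2`, and `q' ≤ q`, so already the real part of `q + q' z` is at least `q /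
2`. -/
lemma cont_le_norm_den (w : List (Fin N)) {z : ℂ} (hz : z ∈ closedDisc) :
    (cont w : ℝ) / 2 ≤ ‖den w z‖ := by
  refine le_trans ?_ (Complex.re_le_norm _)
  have h1 : -(1 / 2) ≤ z.re := by
    have := re_add_pos hz le_rfl
    simp at this
    linarith
  have h2 : ((mob w).2.2 : ℝ) ≤ (mob w).2.1 := by exact_mod_cast (mob_bounds w).2.1
  have h3 : (0 : ℝ) ≤ (mob w).2.2 := Nat.cast_nonneg _
  simp only [cont, den, Complex.add_re, Complex.mul_re, Complex.natCast_re, Complex.natCast_im]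
  nlinarith

lemma den_ne_zero (w : List (Fin N)) {z : ℂ} (hz : z ∈ closedDisc) : den w z ≠ 0 := by
  have := cont_le_norm_den w hz
  have h := cont_pos' w
  exact norm_pos_iff.mp (by linarith)

lemma inv_add_mem_closedDisc {z : ℂ} (hz : z ∈ closedDisc) {k : ℕ} (hk : 1 ≤ k) :
    1 / (z + k) ∈ closedDisc :=
  openDisc_subset (inv_mem_openDisc (re_add_pos hz hk))

lemma phi_mem_closedDisc (w : List (Fin N)) {z : ℂ} (hz : z ∈ closedDisc) :
    phi w z ∈ closedDisc := by
  induction w with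
  | nil => simpa using hz
  | cons i w ih =>
    rw [phi_cons i w (den_ne_zero w hz)]
    exact inv_add_mem_closedDisc ih (Nat.le_add_left 1 i)

/-- The weight with which the word `w` enters the iterates of the operator. -/
noncomputable def weight (σ : ℝ) : List (Fin N) → ℂ → ℂ
  | [], _ => 1
  | i :: w, z => weight σ w z * (1 / (phi w z + ((i + 1 : ℕ) : ℂ)) ^ (σ : ℂ))

/-- Principal powers need not be multiplicative, so the weight is kept as a product of powers. Its
modulus is insensitive to branches because `σ` is real. -/
lemma norm_weight (σ : ℝ) (w : List (Fin N)) {z : ℂ} (hz : z ∈ closedDisc) :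
    ‖weight σ w z‖ = ‖den w z‖ ^ (-σ) := by
  induction w with
  | nil => simp [weight]
  | cons i w ih =>
    have hne := add_ne_zero' (phi_mem_closedDisc w hz) (Nat.le_add_left 1 i)
    rw [weight, norm_mul, ih, den_cons i w (den_ne_zero w hz), norm_mul,
      Real.mul_rpow (norm_nonneg _) (norm_nonneg _), norm_div, norm_one,
      Complex.norm_cpow_of_ne_zero hne]
    simp [Real.rpow_neg]

lemma weight_ofReal (σ : ℝ) (w : List (Fin N)) {x : ℝ} (hx : x ∈ Icc (0 : ℝ) 1) :
    weight σ w (x : ℂ) = ((den w x ^ (-σ) : ℝ) : ℂ) := by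
  induction w with
  | nil => simp [weight]
  | cons i w ih =>
    have h1 := (phi_mem_Icc w hx).1
    have hpos : 0 < phi w x + ((i + 1 : ℕ) : ℝ) := by positivity
    rw [weight, ih, den_cons i w (den_pos w hx).ne', Real.mul_rpow (den_pos w hx).le hpos.le,
      Complex.ofReal_mul, ← ofReal_phi, ← Complex.ofReal_natCast, ← Complex.ofReal_add,
      ← Complex.ofReal_cpow hpos.le, ← Complex.ofReal_one, ← Complex.ofReal_div,
      Real.rpow_neg hpos.le, one_div]

section General

variable {P : Type*}

lemma evalAt_coe (f : V P) (z : closedDisc) (t : P) : evalAt f z t = f.1 t z := onPlane_coe _ _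

lemma V_ext {f g : V P} (h : ∀ z ∈ closedDisc, ∀ t, evalAt f z t = evalAt g z t) : f = g := by
  refine Subtype.ext (funext fun t => ContinuousMap.ext fun z => ?_)
  rw [← evalAt_coe, ← evalAt_coe]
  exact h z z.2 t

lemma evalAt_add (f g : V P) (z : ℂ) (t : P) : evalAt (f + g) z t = evalAt f z t + evalAt g z t := by
  simp [evalAt, onPlane_add]

lemma evalAt_smul (c : ℝ) (f : V P) (z : ℂ) (t : P) :
    evalAt (c • f) z t = (c : ℂ) * evalAt f z t := by
  simp [evalAt, onPlane_smul]

lemma evalAt_sum {ι : Type*} (s : Finset ι) (f : ι → V P) (z : ℂ) (t : P) :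
    evalAt (∑ i ∈ s, f i) z t = ∑ i ∈ s, evalAt (f i) z t := by
  let e : V P →+ ℂ := ⟨⟨fun f => evalAt f z t, by simpa using evalAt_smul 0 (0 : V P) z t⟩,
    fun f g => evalAt_add f g z t⟩
  exact map_sum e f s

lemma evalAt_im (f : V P) {x : ℝ} (hx : x ∈ Icc (0 : ℝ) 1) (t : P) :
    (evalAt f (x : ℂ) t).im = 0 := by
  have := (f.2 t).2 ⟨x, ofReal_mem_closedDisc hx⟩ (Complex.ofReal_im x)
  rwa [← evalAt_coe] at this

lemma ofReal_evalAt_re (f : V P) {x : ℝ} (hx : x ∈ Icc (0 : ℝ) 1) (t : P) :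
    (((evalAt f (x : ℂ) t).re : ℝ) : ℂ) = evalAt f (x : ℂ) t :=
  Complex.ext (by simp) (by simp [evalAt_im f hx t])

lemma continuousOn_evalAt (f : V P) (t : P) : ContinuousOn (fun z => evalAt f z t) closedDisc :=
  continuousOn_onPlane _

lemma continuousOn_evalAt_re (f : V P) (t : P) :
    ContinuousOn (fun x : ℝ => (evalAt f (x : ℂ) t).re) (Icc 0 1) :=
  Complex.continuous_re.comp_continuousOn
    ((continuousOn_evalAt f t).comp Complex.continuous_ofReal.continuousOn
      fun _ hx => ofReal_mem_closedDisc hx)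

lemma evalAt_truncGK [MulAction PGL2Z P] (σ : ℝ) (f : V P) {z : ℂ} (hz : z ∈ closedDisc) (t : P) :
    evalAt (truncGK P σ N f) z t = truncSum σ N f z t :=
  evalAt_coe (truncGK P σ N f) ⟨z, hz⟩ t

/-- The function with the constant value `c`. -/
noncomputable def constV (P : Type*) (c : ℝ) : V P :=
  ⟨fun _ => ContinuousMap.const _ (c : ℂ), fun t => by
    refine ⟨(differentiableOn_const (c : ℂ)).congr fun z hz => ?_, fun z _ => by simp⟩
    exact onPlane_coe _ ⟨z, openDisc_subset hz⟩⟩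

lemma evalAt_constV (c : ℝ) {z : ℂ} (hz : z ∈ closedDisc) (t : P) :
    evalAt (constV P c) z t = c :=
  evalAt_coe (constV P c) ⟨z, hz⟩ t

lemma truncSum_ofReal_re [MulAction PGL2Z P] (σ : ℝ) (f : V P) {x : ℝ} (hx : x ∈ Icc (0 : ℝ) 1)
    (t : P) : (truncSum σ N f x t).re = ∑ i : Fin N, (x + ((i + 1 : ℕ) : ℝ)) ^ (-σ) *
      (evalAt f ((1 / (x + ((i + 1 : ℕ) : ℝ)) : ℝ) : ℂ) (act (redGen ((i + 1 : ℕ) : ℤ)) t)).re := by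
  rw [truncSum, sum_Icc_eq_sum_fin, Complex.re_sum]
  refine Finset.sum_congr rfl fun i _ => ?_
  have h0 := hx.1
  have hpos : 0 < x + ((i + 1 : ℕ) : ℝ) := by positivity
  have h1 : (1 / ((x : ℂ) + ((i + 1 : ℕ) : ℂ)) ^ (σ : ℂ)) =
      (((x + ((i + 1 : ℕ) : ℝ)) ^ (-σ) : ℝ) : ℂ) := by
    rw [← Complex.ofReal_natCast, ← Complex.ofReal_add, ← Complex.ofReal_cpow hpos.le,
      ← Complex.ofReal_one, ← Complex.ofReal_div, Real.rpow_neg hpos.le, one_div]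
  have h2 : (1 / ((x : ℂ) + ((i + 1 : ℕ) : ℂ))) = ((1 / (x + ((i + 1 : ℕ) : ℝ)) : ℝ) : ℂ) := by
    push_cast
    rfl
  rw [h1, h2, Complex.re_ofReal_mul]

end General

lemma evalAt_pow (σ : ℝ) (n : ℕ) (f : V Unit) {z : ℂ} (hz : z ∈ closedDisc) :
    evalAt ((truncGK Unit σ N ^ n) f) z () =
      wordSum N n fun w => weight σ w z * evalAt f (phi w z) () := by
  induction n generalizing f with
  | zero => simp [weight]
  | succ n ih =>
    rw [pow_succ, Module.End.mul_apply, ih, wordSum_succ']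
    simp only [wordSum]
    refine Finset.sum_congr rfl fun u _ => ?_
    rw [evalAt_truncGK σ f (phi_mem_closedDisc _ hz), truncSum, sum_Icc_eq_sum_fin, Finset.mul_sum]
    refine Finset.sum_congr rfl fun i _ => ?_
    rw [weight, phi_cons _ _ (den_ne_zero _ hz), mul_assoc]

lemma norm_evalAt_pow_one_le {σ : ℝ} (hσ : 0 ≤ σ) (n : ℕ) {z : ℂ} (hz : z ∈ closedDisc) :
    ‖evalAt ((truncGK Unit σ N ^ n) (constV Unit 1)) z ()‖ ≤ 2 ^ σ * partition N σ n := by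
  rw [evalAt_pow σ n _ hz, wordSum, partition, wordSum, Finset.mul_sum]
  refine norm_sum_le_of_le _ fun f _ => ?_
  rw [evalAt_constV 1 (phi_mem_closedDisc _ hz), Complex.ofReal_one, mul_one, norm_weight _ _ hz]
  have hq := cont_pos' (List.ofFn f)
  calc ‖den (List.ofFn f) z‖ ^ (-σ) ≤ ((cont (List.ofFn f) : ℝ) / 2) ^ (-σ) :=
        Real.rpow_le_rpow_of_nonpos (by positivity) (cont_le_norm_den _ hz) (by linarith)
    _ = _ := by
        rw [Real.div_rpow hq.le zero_le_two, Real.rpow_neg zero_le_two, div_inv_eq_mul, mul_comm]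

lemma le_evalAt_pow_one_re {σ : ℝ} (hσ : 0 ≤ σ) (n : ℕ) {x : ℝ} (hx : x ∈ Icc (0 : ℝ) 1) :
    2 ^ (-σ) * partition N σ n ≤ (evalAt ((truncGK Unit σ N ^ n) (constV Unit 1)) x ()).re := by
  rw [evalAt_pow σ n _ (ofReal_mem_closedDisc hx), wordSum, partition, wordSum, Finset.mul_sum,
    Complex.re_sum]
  refine Finset.sum_le_sum fun f _ => ?_
  have hz := phi_mem_closedDisc (List.ofFn f) (ofReal_mem_closedDisc hx)
  rw [evalAt_constV 1 hz, Complex.ofReal_one, mul_one, weight_ofReal _ _ hx, Complex.ofReal_re,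
    ← Real.mul_rpow zero_le_two (cont_pos' _).le]
  exact Real.rpow_le_rpow_of_nonpos (den_pos _ hx) (den_le_cont _ hx) (by linarith)

/-! ## Equicontinuity -/

/-- The constant `2/5` is the positive root of `5a²/4 + 2a = 1`, the borderline case for real `w`.
It allows the radius `8/5`, since `Re z > -3/5` there and `k ≥ 1`. -/
lemma inv_mem_openDisc' {w : ℂ} (hw : 2 / 5 < w.re) : 1 / w ∈ openDisc := by
  have hw0 : w ≠ 0 := by
    rintro rfl
    norm_num at hw
  have hpos : 0 < ‖w‖ := norm_pos_iff.mpr hw0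
  have hlt : ‖1 - w‖ < 3 / 2 * ‖w‖ := by
    rw [← sq_lt_sq₀ (norm_nonneg _) (by positivity), mul_pow, ← Complex.normSq_eq_norm_sq,
      ← Complex.normSq_eq_norm_sq, Complex.normSq_apply, Complex.normSq_apply]
    simp
    nlinarith
  have : 1 / w - 1 = (1 - w) / w := by field_simp
  rw [openDisc, Metric.mem_ball, dist_eq_norm, this, norm_div, div_lt_iff₀ hpos]
  exact hlt

lemma re_add_gt {z : ℂ} (hz : z ∈ Metric.ball (1 : ℂ) (8 / 5)) {k : ℕ} (hk : 1 ≤ k) :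
    2 / 5 < (z + k).re := by
  have h1 : ‖z - 1‖ < 8 / 5 := by simpa [dist_eq_norm] using hz
  have h2 := (abs_le.mp (Complex.abs_re_le_norm (z - 1))).1
  have hk' : (1 : ℝ) ≤ k := by exact_mod_cast hk
  simp at h2 ⊢
  linarith

variable {P : Type*} [MulAction PGL2Z P]

lemma differentiableOn_truncSum_ball (σ : ℝ) (f : V P) (t : P) :
    DifferentiableOn ℂ (fun z => truncSum σ N f z t) (Metric.ball 1 (8 / 5)) := by
  refine DifferentiableOn.fun_sum fun k hk => ?_
  have hk := (Finset.mem_Icc.mp hk).1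
  have hadd : DifferentiableOn ℂ (fun z : ℂ => z + k) (Metric.ball 1 (8 / 5)) := by fun_prop
  have hslit : ∀ z ∈ Metric.ball (1 : ℂ) (8 / 5), z + k ∈ Complex.slitPlane := fun z hz =>
    Or.inl (by linarith [re_add_gt hz hk])
  refine DifferentiableOn.mul ?_ ?_
  · refine (differentiableOn_const 1).div (hadd.cpow_const hslit) fun z hz => ?_
    simp [Complex.cpow_eq_zero_iff, Complex.slitPlane_ne_zero (hslit z hz)]
  · exact (f.2 _).1.comp ((differentiableOn_const 1).div hadd fun z hz =>
      Complex.slitPlane_ne_zero (hslit z hz)) fun z hz => inv_mem_openDisc' (re_add_gt hz hk)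

lemma norm_truncSum_le {σ B : ℝ} (hσ : 0 ≤ σ) {f : V P}
    (hf : ∀ z ∈ closedDisc, ∀ t, ‖evalAt f z t‖ ≤ B) {z : ℂ} (hz : z ∈ Metric.ball (1 : ℂ) (8 / 5))
    (t : P) : ‖truncSum σ N f z t‖ ≤ N * ((2 / 5) ^ (-σ) * B) := by
  have : ∀ k ∈ Finset.Icc 1 N,
      ‖1 / (z + k) ^ (σ : ℂ) * evalAt f (1 / (z + k)) (act (redGen k) t)‖ ≤
        (2 / 5) ^ (-σ) * B := by
    intro k hk
    have hre := re_add_gt hz (Finset.mem_Icc.mp hk).1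
    have hnorm : 2 / 5 ≤ ‖z + k‖ := hre.le.trans (Complex.re_le_norm _)
    have hne : z + k ≠ 0 := norm_pos_iff.mp (by linarith)
    rw [norm_mul]
    refine mul_le_mul ?_ (hf _ (openDisc_subset (inv_mem_openDisc' hre)) _) (norm_nonneg _)
      (by positivity)
    rw [norm_div, norm_one, Complex.norm_cpow_of_ne_zero hne]
    simp only [Complex.ofReal_re, Complex.ofReal_im, mul_zero, Real.exp_zero, div_one]
    rw [one_div, ← Real.rpow_neg (norm_nonneg _)]
    exact Real.rpow_le_rpow_of_nonpos (by norm_num) hnorm (by linarith)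
  refine (norm_sum_le_of_le _ this).trans ?_
  simp

/-- Cauchy's estimate on circles of radius `1/20` bounds the derivative: these circles stay in the
disc of radius `8/5`, as `3/2 + 1/20 < 8/5`. -/
lemma lipschitzOnWith_truncSum {σ B : ℝ} (hσ : 0 ≤ σ) {f : V P}
    (hf : ∀ z ∈ closedDisc, ∀ t, ‖evalAt f z t‖ ≤ B) (t : P) :
    LipschitzOnWith (Real.toNNReal (N * ((2 / 5) ^ (-σ) * B) / (1 / 20)))
      (fun z => truncSum σ N f z t) closedDisc := by
  have hsub : ∀ z ∈ closedDisc, Metric.closedBall z (1 / 20) ⊆ Metric.ball (1 : ℂ) (8 / 5) := by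
    intro z hz
    refine Metric.closedBall_subset_ball' ?_
    have : dist z 1 ≤ 3 / 2 := hz
    linarith
  refine Convex.lipschitzOnWith_of_nnnorm_deriv_le (𝕜 := ℂ) (fun z hz => ?_) (fun z hz => ?_)
    (convex_closedBall _ _)
  · exact (differentiableOn_truncSum_ball σ f t).differentiableAt
      (Metric.isOpen_ball.mem_nhds (hsub z hz (Metric.mem_closedBall_self (by norm_num))))
  · rw [← NNReal.coe_le_coe, coe_nnnorm]
    refine le_trans ?_ (Real.le_coe_toNNReal _)
    refine Complex.norm_deriv_le_of_forall_mem_sphere_norm_le (by norm_num) ?_ fun u hu =>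
      norm_truncSum_le hσ hf (hsub z hz (Metric.sphere_subset_closedBall hu)) t
    refine ((differentiableOn_truncSum_ball σ f t).mono ?_).diffContOnCl
    rw [closure_ball z (by norm_num)]
    exact hsub z hz

/-- Functions in the image of a ball under the operator form a relatively compact set. -/
lemma exists_subseq_tendstoUniformly {σ B : ℝ} (hσ : 0 ≤ σ) {f : ℕ → V P}
    (hf : ∀ n, ∀ z ∈ closedDisc, ∀ t, ‖evalAt (f n) z t‖ ≤ B) (t : P) :
    ∃ (g : C(closedDisc, ℂ)) (φ : ℕ → ℕ), StrictMono φ ∧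
      TendstoUniformly (fun n (z : closedDisc) => truncSum σ N (f (φ n)) z t) g Filter.atTop := by
  let F : ℕ → BoundedContinuousFunction closedDisc ℂ := fun n =>
    BoundedContinuousFunction.mkOfCompact (truncFun σ N (f n) t)
  have hF : ∀ n z, F n z = truncSum σ N (f n) z t := fun n z => rfl
  have hcomp : IsCompact (closure (range F)) := by
    refine BoundedContinuousFunction.arzela_ascoli
      (Metric.closedBall 0 (N * ((2 / 5) ^ (-σ) * B))) (isCompact_closedBall _ _) _ ?_ ?_
    · rintro _ z ⟨n, rfl⟩
      rw [mem_closedBall_zero_iff, hF]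
      refine norm_truncSum_le hσ (hf n) ?_ t
      exact Metric.closedBall_subset_ball (by norm_num) z.2
    · refine UniformEquicontinuous.equicontinuous ?_
      refine LipschitzWith.uniformEquicontinuous _
        (Real.toNNReal (N * ((2 / 5) ^ (-σ) * B) / (1 / 20))) ?_
      rintro ⟨_, n, rfl⟩
      have := (lipschitzOnWith_truncSum (N := N) hσ (hf n) t).to_restrict
      exact this
  obtain ⟨g, -, φ, hφ, hlim⟩ := hcomp.tendsto_subseq fun n => subset_closure (mem_range_self n)
  exact ⟨g.toContinuousMap, φ, hφ,
    BoundedContinuousFunction.tendsto_iff_tendstoUniformly.mp hlim⟩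

/-- At a parameter at which the partition functions are bounded above and below, the operator has
a positive fixed function. -/
lemma exists_fixed {σ : ℝ} (hσ : 0 ≤ σ)
    (hZ : ∀ n, 1 ≤ partition N σ n ∧ partition N σ n ≤ 2 ^ σ) :
    ∃ h : V Unit, truncGK Unit σ N h = h ∧
      ∀ x ∈ Icc (0 : ℝ) 1, 0 < (evalAt h (x : ℂ) ()).re := by
  set L := truncGK Unit σ N with hL
  -- One factor `2 ^ σ` comes from the distortion on the disc, the other from the bound on the
  -- partition function.
  set B : ℝ := 2 ^ σ * 2 ^ σ with hB
  set u : ℕ → V Unit := fun n => (L ^ n) (constV Unit 1) with hu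
  have hub : ∀ n, ∀ z ∈ closedDisc, ‖evalAt (u n) z ()‖ ≤ B := fun n z hz =>
    (norm_evalAt_pow_one_le hσ n hz).trans
      (mul_le_mul_of_nonneg_left (hZ n).2 (by positivity))
  have hul : ∀ n, ∀ x ∈ Icc (0 : ℝ) 1, (2 : ℝ) ^ (-σ) ≤ (evalAt (u n) (x : ℂ) ()).re :=
    fun n x hx => le_trans (le_mul_of_one_le_right (by positivity) (hZ n).1)
      (le_evalAt_pow_one_re hσ n hx)
  set A : ℕ → V Unit := fun n => ((n + 1 : ℝ)⁻¹) • ∑ k ∈ Finset.range (n + 1), u k with hA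
  have hAe : ∀ n z, evalAt (A n) z () =
      ((n + 1 : ℝ)⁻¹ : ℝ) * ∑ k ∈ Finset.range (n + 1), evalAt (u k) z () := fun n z => by
    rw [hA, evalAt_smul, evalAt_sum]
  have hAb : ∀ n, ∀ z ∈ closedDisc, ∀ t, ‖evalAt (A n) z t‖ ≤ B := by
    intro n z hz t
    rw [hAe, norm_mul, Complex.norm_real, Real.norm_eq_abs, abs_of_pos (by positivity),
      inv_mul_le_iff₀ (by positivity)]
    refine (norm_sum_le_of_le _ fun k _ => hub k z hz).trans ?_
    simp
  have hAl : ∀ n, ∀ x ∈ Icc (0 : ℝ) 1, (2 : ℝ) ^ (-σ) ≤ (evalAt (A n) (x : ℂ) ()).re := by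
    intro n x hx
    rw [hAe, Complex.re_ofReal_mul, Complex.re_sum, le_inv_mul_iff₀ (by positivity)]
    refine le_trans ?_ (Finset.sum_le_sum fun k _ => hul k x hx)
    simp
  -- The means are almost fixed: the difference telescopes to `(u (n + 1) - u 0) / (n + 1)`.
  have hdiff : ∀ n, ∀ z ∈ closedDisc, ‖truncSum σ N (A n) z () - evalAt (A n) z ()‖ ≤
      (2 * B) * (1 / ((n : ℝ) + 1)) := by
    intro n z hz
    have h1 : L (A n) = ((n + 1 : ℝ)⁻¹) • ∑ k ∈ Finset.range (n + 1), u (k + 1) := by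
      simp only [hA, map_smul, map_sum, hu, pow_succ', Module.End.mul_apply]
    have h2 : evalAt (L (A n)) z () =
        ((n + 1 : ℝ)⁻¹ : ℝ) * ∑ k ∈ Finset.range (n + 1), evalAt (u (k + 1)) z () := by
      rw [h1, evalAt_smul, evalAt_sum]
    rw [← evalAt_truncGK σ _ hz, ← hL, h2, hAe, ← mul_sub, ← Finset.sum_sub_distrib,
      Finset.sum_range_sub (fun k => evalAt (u k) z ()), norm_mul, Complex.norm_real,
      Real.norm_eq_abs, abs_of_pos (by positivity), mul_comm, one_div]
    refine mul_le_mul_of_nonneg_right ?_ (by positivity)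
    refine (norm_sub_le _ _).trans ?_
    linarith [hub (n + 1) z hz, hub 0 z hz]
  obtain ⟨g, φ, hφ, hlim⟩ := exists_subseq_tendstoUniformly (N := N) hσ hAb ()
  have hsmall : Filter.Tendsto (fun n => (2 * B) * (1 / ((φ n : ℝ) + 1))) Filter.atTop
      (nhds 0) := by
    have := (tendsto_one_div_add_atTop_nhds_zero_nat (𝕜 := ℝ)).const_mul (2 * B)
    rw [mul_zero] at this
    exact this.comp hφ.tendsto_atTop
  -- Compactness concerns the images of the means; by `hdiff` the means themselves have the same
  -- limit.
  have hAlim : TendstoUniformly (fun n (z : closedDisc) => evalAt (A (φ n)) z ()) g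
      Filter.atTop := by
    rw [Metric.tendstoUniformly_iff] at hlim ⊢
    intro ε hε
    filter_upwards [hlim (ε / 2) (by positivity), hsmall.eventually_lt_const (half_pos hε)]
      with n h1 h2 z
    have h3 := h1 z
    have h4 := hdiff (φ n) z z.2
    rw [← dist_eq_norm] at h4
    linarith [dist_triangle (g z) (truncSum σ N (A (φ n)) z ()) (evalAt (A (φ n)) z ())]
  have hAon : TendstoUniformlyOn (fun n z => evalAt (A (φ n)) z ()) (onPlane g) Filter.atTop
      closedDisc := by
    rw [Metric.tendstoUniformlyOn_iff]
    rw [Metric.tendstoUniformly_iff] at hAlim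
    intro ε hε
    filter_upwards [hAlim ε hε] with n hn z hz
    have := hn ⟨z, hz⟩
    rwa [← onPlane_coe] at this
  let h : V Unit := ⟨fun _ => g, fun t => by
    refine ⟨?_, fun z hz => ?_⟩
    · exact (hAon.mono openDisc_subset).tendstoLocallyUniformlyOn.differentiableOn
        (Filter.Eventually.of_forall fun n => ((A (φ n)).2 ()).1) Metric.isOpen_ball
    · have h1 := (Complex.continuous_im.tendsto _).comp (hAlim.tendsto_at z)
      refine tendsto_nhds_unique h1 (Filter.Tendsto.congr (fun n => ?_) tendsto_const_nhds)
      have := ((A (φ n)).2 ()).2 z hz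
      rw [← evalAt_coe] at this
      exact this.symm⟩
  have hpt : ∀ z ∈ closedDisc, Filter.Tendsto (fun n => evalAt (A (φ n)) z ()) Filter.atTop
      (nhds (evalAt h z ())) := fun z hz => hAon.tendsto_at hz
  refine ⟨h, V_ext fun z hz t => ?_, fun x hx => ?_⟩
  · rw [evalAt_truncGK σ h hz]
    have h1 : Filter.Tendsto (fun n => truncSum σ N (A (φ n)) z ()) Filter.atTop
        (nhds (truncSum σ N h z ())) := by
      refine tendsto_finsetSum _ fun k hk => ?_
      exact (hpt _ (inv_add_mem_closedDisc hz (Finset.mem_Icc.mp hk).1)).const_mul _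
    have h2 := hlim.tendsto_at ⟨z, hz⟩
    rw [← onPlane_coe] at h2
    exact tendsto_nhds_unique h1 h2
  · refine lt_of_lt_of_le (by positivity : (0 : ℝ) < 2 ^ (-σ)) ?_
    exact ge_of_tendsto' ((Complex.continuous_re.tendsto _).comp
      (hpt _ (ofReal_mem_closedDisc hx))) fun n => hAl _ x hx

end Operator

/-! ## The Hausdorff measure of `E_N` is finite -/

section Upper

variable {N : ℕ}

lemma exists_letter {β : ℝ} (hβ : β ∈ cantorE N) :
    gaussMap β ∈ cantorE N ∧ ∃ i : Fin N, β = 1 / (gaussMap β + ((i + 1 : ℕ) : ℝ)) := by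
  obtain ⟨⟨h0, h1⟩, hirr, hdig⟩ := hβ
  have hpos : 0 < β := h0.lt_of_ne hirr.ne_zero.symm
  refine ⟨⟨⟨Int.fract_nonneg _, (Int.fract_lt_one _).le⟩, ?_, fun n => hdig (n + 1)⟩, ?_⟩
  · have : gaussMap β = 1 / β - (⌊1 / β⌋ : ℤ) := rfl
    rw [this, one_div]
    exact hirr.inv.sub_intCast _
  · have hfl : (1 : ℤ) ≤ ⌊1 / β⌋ := Int.le_floor.mpr (by
      rw [Int.cast_one, le_div_iff₀ hpos]
      linarith)
    have hfl' : ⌊1 / β⌋ ≤ N := hdig 0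
    refine ⟨⟨(⌊1 / β⌋ - 1).toNat, by omega⟩, ?_⟩
    have hcast : ((((⌊1 / β⌋ - 1).toNat + 1 : ℕ) : ℤ) : ℝ) = (⌊1 / β⌋ : ℝ) := by
      rw [show (((⌊1 / β⌋ - 1).toNat + 1 : ℕ) : ℤ) = ⌊1 / β⌋ by omega]
    rw [Int.cast_natCast] at hcast
    simp only [hcast, gaussMap, Int.fract_add_floor, one_div_one_div]

lemma exists_word (n : ℕ) {β : ℝ} (hβ : β ∈ cantorE N) :
    ∃ f : Fin n → Fin N, β ∈ phi (List.ofFn f) '' Icc (0 : ℝ) 1 := by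
  induction n generalizing β with
  | zero => exact ⟨Fin.elim0, β, hβ.1, by simp⟩
  | succ n ih =>
    obtain ⟨hg, i, hi⟩ := exists_letter hβ
    obtain ⟨f, x, hx, hfx⟩ := ih hg
    refine ⟨Fin.cons i f, x, hx, ?_⟩
    rw [List.ofFn_cons, phi_cons _ _ (den_pos _ hx).ne', hfx, ← hi]

lemma ediam_phi_image_le (w : List (Fin N)) :
    Metric.ediam (phi w '' Icc (0 : ℝ) 1) ≤ ENNReal.ofReal (1 / (cont w : ℝ) ^ 2) := by
  refine Metric.ediam_le ?_
  rintro _ ⟨x, hx, rfl⟩ _ ⟨y, hy, rfl⟩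
  rw [edist_dist, Real.dist_eq]
  exact ENNReal.ofReal_le_ofReal (abs_phi_sub_le w hx hy)

lemma one_div_cont_sq_rpow (σ : ℝ) (w : List (Fin N)) :
    (1 / (cont w : ℝ) ^ 2) ^ (σ / 2) = (cont w : ℝ) ^ (-σ) := by
  have hq := cont_pos' w
  rw [one_div, Real.inv_rpow (by positivity), ← Real.rpow_natCast, ← Real.rpow_mul hq.le,
    Real.rpow_neg hq.le]
  congr 2
  push_cast
  ring

lemma one_div_cont_sq_le (w : List (Fin N)) {n : ℕ} (hn : 0 < n) (hw : n ≤ w.length) :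
    1 / (cont w : ℝ) ^ 2 ≤ 1 / n := by
  have h1 : (n : ℝ) ≤ cont w := by exact_mod_cast hw.trans (length_le_cont w)
  have h2 := one_le_cont w
  have hn' : (0 : ℝ) < n := by exact_mod_cast hn
  refine one_div_le_one_div_of_le hn' ?_
  nlinarith

/-- The images of `[0, 1]` under words of length `n` cover `E_N`, and the sum of their diameters to
the power `σ / 2` is at most `partition N σ n`. -/
lemma hausdorffMeasure_cantorE_lt_top {σ : ℝ} (hσ : 0 < σ)
    (hZ : ∀ n, partition N σ n ≤ 2 ^ σ) :
    Measure.hausdorffMeasure (σ / 2) (cantorE N) < ⊤ := by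
  have hr : Filter.Tendsto (fun n : ℕ => ENNReal.ofReal (1 / (n : ℝ))) Filter.atTop (nhds 0) := by
    rw [← ENNReal.ofReal_zero]
    exact ENNReal.tendsto_ofReal tendsto_one_div_atTop_nhds_zero_nat
  refine lt_of_le_of_lt (Measure.hausdorffMeasure_le_liminf_sum (ι := fun n => Fin n → Fin N)
    (l := Filter.atTop) (σ / 2) (cantorE N) _ hr
    (fun n f => phi (List.ofFn f) '' Icc (0 : ℝ) 1) ?_ ?_)
    (lt_of_le_of_lt ?_ (ENNReal.ofReal_lt_top (r := 2 ^ σ)))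
  · filter_upwards [Filter.eventually_gt_atTop 0] with n hn f
    exact (ediam_phi_image_le _).trans
      (ENNReal.ofReal_le_ofReal (one_div_cont_sq_le _ hn (by simp)))
  · exact Filter.Eventually.of_forall fun n β hβ => mem_iUnion.mpr (exists_word n hβ)
  · refine (Filter.liminf_le_liminf (Filter.Eventually.of_forall fun n => ?_)).trans
      (Filter.liminf_const _).le
    calc ∑ f : Fin n → Fin N, Metric.ediam (phi (List.ofFn f) '' Icc (0 : ℝ) 1) ^ (σ / 2)
        ≤ ∑ f : Fin n → Fin N, ENNReal.ofReal ((cont (List.ofFn f) : ℝ) ^ (-σ)) := by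
          refine Finset.sum_le_sum fun f _ => ?_
          rw [← one_div_cont_sq_rpow, ← ENNReal.ofReal_rpow_of_nonneg (by positivity)
            (by positivity)]
          exact ENNReal.rpow_le_rpow (ediam_phi_image_le _) (by positivity)
      _ = ENNReal.ofReal (partition N σ n) :=
          (ENNReal.ofReal_sum_of_nonneg fun f _ => Real.rpow_nonneg (cont_pos' _).le _).symm
      _ ≤ ENNReal.ofReal (2 ^ σ) := ENNReal.ofReal_le_ofReal (hZ n)

end Upper

/-! ## The coding map -/

section Coding

variable {N : ℕ}

/-- The first `n` letters of a sequence, as a word. -/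
def pref (n : ℕ) (a : ℕ → Fin N) : List (Fin N) := List.ofFn fun i : Fin n => a i

/-- The shift on sequences. -/
def shift (a : ℕ → Fin N) : ℕ → Fin N := fun n => a (n + 1)

@[simp] lemma length_pref (n : ℕ) (a : ℕ → Fin N) : (pref n a).length = n := List.length_ofFn

lemma pref_succ (n : ℕ) (a : ℕ → Fin N) : pref (n + 1) a = a 0 :: pref n (shift a) := by
  simp [pref, shift, List.ofFn_succ]

lemma pref_succ' (n : ℕ) (a : ℕ → Fin N) : pref (n + 1) a = pref n a ++ [a n] := by
  rw [pref, List.ofFn_succ_last]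
  rfl

lemma phi_append (u v : List (Fin N)) {x : ℝ} (hx : x ∈ Icc (0 : ℝ) 1) :
    phi (u ++ v) x = phi u (phi v x) := by
  induction u with
  | nil => simp
  | cons i u ih =>
    rw [List.cons_append, phi_cons _ _ (den_pos _ hx).ne', ih,
      phi_cons _ _ (den_pos _ (phi_mem_Icc v hx)).ne']

lemma exists_code (a : ℕ → Fin N) : ∃ x : ℝ, ∀ n, x ∈ phi (pref n a) '' Icc (0 : ℝ) 1 := by
  have hcomp : ∀ n, IsCompact (phi (pref n a) '' Icc (0 : ℝ) 1) := fun n =>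
    isCompact_Icc.image_of_continuousOn (continuousOn_phi _)
  have := IsCompact.nonempty_iInter_of_sequence_nonempty_isCompact_isClosed
    (fun n => phi (pref n a) '' Icc (0 : ℝ) 1) (fun n => ?_) (fun n => ?_) (hcomp 0)
    fun n => (hcomp n).isClosed
  · obtain ⟨x, hx⟩ := this
    exact ⟨x, mem_iInter.mp hx⟩
  · rintro _ ⟨x, hx, rfl⟩
    rw [pref_succ', phi_append _ _ hx]
    exact mem_image_of_mem _ (phi_mem_Icc _ hx)
  · exact (nonempty_Icc.mpr zero_le_one).image _

/-- The point of `[0, 1]` with the given sequence of partial quotients. -/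
noncomputable def code (a : ℕ → Fin N) : ℝ := (exists_code a).choose

lemma code_mem (a : ℕ → Fin N) (n : ℕ) : code a ∈ phi (pref n a) '' Icc (0 : ℝ) 1 :=
  (exists_code a).choose_spec n

lemma code_mem_Icc (a : ℕ → Fin N) : code a ∈ Icc (0 : ℝ) 1 := by
  obtain ⟨x, hx, h⟩ := code_mem a 0
  simpa [pref, ← h] using hx

lemma abs_sub_le_of_mem_image {w : List (Fin N)} {x y : ℝ} (hx : x ∈ phi w '' Icc (0 : ℝ) 1)
    (hy : y ∈ phi w '' Icc (0 : ℝ) 1) {n : ℕ} (hn : 0 < n) (hw : n ≤ w.length) :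
    |x - y| ≤ 1 / n := by
  obtain ⟨x, hx, rfl⟩ := hx
  obtain ⟨y, hy, rfl⟩ := hy
  exact (abs_phi_sub_le w hx hy).trans (one_div_cont_sq_le w hn hw)

lemma eq_code {a : ℕ → Fin N} {x : ℝ} (hx : ∀ n, x ∈ phi (pref n a) '' Icc (0 : ℝ) 1) :
    x = code a := by
  refine sub_eq_zero.mp (abs_nonpos_iff.mp (le_of_forall_pos_le_add fun ε hε => ?_))
  rw [zero_add]
  obtain ⟨n, hn⟩ := exists_nat_one_div_lt hε
  refine (abs_sub_le_of_mem_image (hx (n + 1)) (code_mem a (n + 1)) n.succ_pos (by simp)).trans ?_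
  push_cast
  exact hn.le

lemma code_eq (a : ℕ → Fin N) : code a = 1 / (code (shift a) + ((a 0 + 1 : ℕ) : ℝ)) := by
  have key : ∀ y ∈ Icc (0 : ℝ) 1, phi [a 0] y = 1 / (y + ((a 0 + 1 : ℕ) : ℝ)) := fun y _ => by
    rw [phi_cons _ _ (by simp), phi_nil]
  obtain ⟨y, hy, hya⟩ := code_mem a 1
  have h1 : pref 1 a = [a 0] := by simp [pref]
  rw [h1] at hya
  have : y = code (shift a) := by
    refine eq_code fun n => ?_
    obtain ⟨x, hx, hxa⟩ := code_mem a (n + 1)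
    refine ⟨x, hx, phi_injOn [a 0] (phi_mem_Icc _ hx) hy ?_⟩
    rw [hya, ← hxa, pref_succ, ← phi_append _ _ hx, List.singleton_append]
  rw [← hya, key y hy, this]

lemma code_eq_phi (n : ℕ) (a : ℕ → Fin N) : code a = phi (pref n a) (code (shift^[n] a)) := by
  induction n generalizing a with
  | zero => simp [pref]
  | succ n ih =>
    rw [pref_succ, phi_cons _ _ (den_pos _ (code_mem_Icc _)).ne', Function.iterate_succ_apply,
      ← ih, ← code_eq]

/-! ### Location, digits and irrationality of the coded points. -/

lemma le_code (a : ℕ → Fin N) : 1 / ((N : ℝ) + 1) ≤ code a := by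
  rw [code_eq]
  have h1 := code_mem_Icc (shift a)
  have h2 : ((a 0 + 1 : ℕ) : ℝ) ≤ N := by exact_mod_cast (a 0).isLt
  have h3 : (0 : ℝ) < ((a 0 + 1 : ℕ) : ℝ) := by positivity
  exact one_div_le_one_div_of_le (by linarith [h1.1]) (by linarith [h1.2])

lemma code_pos (a : ℕ → Fin N) : 0 < code a := lt_of_lt_of_le (by positivity) (le_code a)

lemma code_lt_one (a : ℕ → Fin N) : code a < 1 := by
  rw [code_eq]
  have h1 := code_pos (shift a)
  have h2 : (1 : ℝ) ≤ ((a 0 + 1 : ℕ) : ℝ) := by exact_mod_cast Nat.le_add_left _ _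
  rw [div_lt_one (by linarith)]
  linarith

lemma one_div_code (a : ℕ → Fin N) : 1 / code a = code (shift a) + ((a 0 + 1 : ℕ) : ℝ) := by
  rw [code_eq, one_div_one_div]

lemma gaussMap_code (a : ℕ → Fin N) : gaussMap (code a) = code (shift a) := by
  rw [gaussMap, one_div_code, Int.fract_add_natCast]
  exact Int.fract_eq_self.mpr ⟨(code_pos _).le, code_lt_one _⟩

lemma floor_one_div_code (a : ℕ → Fin N) : ⌊1 / code a⌋ = ((a 0 + 1 : ℕ) : ℤ) := by
  rw [one_div_code, Int.floor_add_natCast, Int.floor_eq_zero_iff.mpr ⟨(code_pos _).le,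
    code_lt_one _⟩, zero_add]

lemma gaussMap_iterate_code (n : ℕ) (a : ℕ → Fin N) :
    gaussMap^[n] (code a) = code (shift^[n] a) := by
  induction n generalizing a with
  | zero => rfl
  | succ n ih => rw [Function.iterate_succ_apply, gaussMap_code, ih, Function.iterate_succ_apply]

/-- Euclidean descent: if `code a = m / n`, then `m < n` and `code (shift a)` is a fraction with the
smaller denominator `m`. For `n = 0` the quotient is `0`, which is not a coded point. -/
lemma code_ne_div (n : ℕ) (m : ℕ) (a : ℕ → Fin N) : code a ≠ (m : ℝ) / n := by
  induction n using Nat.strong_induction_on generalizing m a with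
  | _ n ih =>
    intro h
    have h0 := code_pos a
    have h1 := code_lt_one a
    have hn : (0 : ℝ) < n := by
      rcases Nat.eq_zero_or_pos n with rfl | hn
      · simp at h
        linarith
      · exact_mod_cast hn
    have hm : (0 : ℝ) < m := by
      rw [h] at h0
      exact (div_pos_iff_of_pos_right hn).mp h0
    rw [h, div_lt_one hn] at h1
    have h2 := one_div_code a
    rw [h, one_div_div] at h2
    have h3 : code (shift a) * m = n - ((a 0 + 1 : ℕ) : ℝ) * m := by
      have : (n : ℝ) / m * m = n := div_mul_cancel₀ _ hm.ne'
      rw [h2] at this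
      linarith
    have h4 : (a 0 + 1) * m ≤ n := by
      have : (0 : ℝ) ≤ code (shift a) * m := mul_nonneg (code_pos _).le hm.le
      have : ((a 0 + 1 : ℕ) : ℝ) * m ≤ n := by linarith
      exact_mod_cast this
    refine ih m (by exact_mod_cast h1) (n - (a 0 + 1) * m) (shift a) ?_
    rw [eq_div_iff hm.ne', h3, Nat.cast_sub h4, Nat.cast_mul]

lemma irrational_code (a : ℕ → Fin N) : Irrational (code a) := by
  rintro ⟨r, hr⟩
  have hnum : 0 ≤ r.num := by
    rw [Rat.num_nonneg]
    have : (0 : ℝ) ≤ r := by rw [hr]; exact (code_pos a).le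
    exact_mod_cast this
  refine code_ne_div r.den r.num.toNat a ?_
  rw [← hr, Rat.cast_def]
  congr 1
  have : ((r.num.toNat : ℤ) : ℝ) = (r.num : ℝ) := by rw [Int.toNat_of_nonneg hnum]
  rw [← this, Int.cast_natCast]

lemma code_mem_cantorE (a : ℕ → Fin N) : code a ∈ cantorE N := by
  refine ⟨code_mem_Icc a, irrational_code a, fun n => ?_⟩
  rw [cfDigit, gaussMap_iterate_code, floor_one_div_code]
  exact_mod_cast (shift^[n] a 0).isLt

lemma shift_iterate (n : ℕ) (a : ℕ → Fin N) (k : ℕ) : shift^[n] a k = a (k + n) := by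
  induction n generalizing a with
  | zero => rfl
  | succ n ih =>
    rw [Function.iterate_succ_apply, ih]
    simp only [shift]
    congr 1

/-- The first letters differ by at least 1 and the tails by at most `1 - 1/(N+1)`, so the
reciprocals are `1/(N+1)` apart. Each reciprocal is at most `N + 1`, which accounts for the other
two factors. -/
lemma le_abs_code_sub {a b : ℕ → Fin N} (h : a 0 ≠ b 0) :
    1 / ((N : ℝ) + 1) ^ 3 ≤ |code a - code b| := by
  have ha := le_code (shift a)
  have hb := le_code (shift b)
  have ha' := (code_mem_Icc (shift a)).2
  have hb' := (code_mem_Icc (shift b)).2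
  have hNa : ((a 0 + 1 : ℕ) : ℝ) ≤ N := by exact_mod_cast (a 0).isLt
  have hNb : ((b 0 + 1 : ℕ) : ℝ) ≤ N := by exact_mod_cast (b 0).isLt
  have hpos : (0 : ℝ) < 1 / ((N : ℝ) + 1) := by positivity
  have hone : (1 : ℝ) ≤ |((a 0 + 1 : ℕ) : ℝ) - ((b 0 + 1 : ℕ) : ℝ)| := by
    have : ((a 0 + 1 : ℕ) : ℤ) - ((b 0 + 1 : ℕ) : ℤ) ≠ 0 := by
      intro h'
      exact h (Fin.ext (by omega))
    have := Int.one_le_abs this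
    exact_mod_cast this
  have h3 : (0 : ℝ) < ((a 0 + 1 : ℕ) : ℝ) := by positivity
  have h4 : (0 : ℝ) < ((b 0 + 1 : ℕ) : ℝ) := by positivity
  rw [code_eq a, code_eq b]
  set x := code (shift a)
  set y := code (shift b)
  set k := ((a 0 + 1 : ℕ) : ℝ)
  set l := ((b 0 + 1 : ℕ) : ℝ)
  have hA : 0 < x + k := by linarith
  have hB : 0 < y + l := by linarith
  have hxy : |y - x| ≤ 1 - 1 / ((N : ℝ) + 1) := by
    rw [abs_le]; constructor <;> linarith
  have hnum : 1 / ((N : ℝ) + 1) ≤ |(y + l) - (x + k)| := by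
    have : |k - l| ≤ |(y + l) - (x + k)| + |y - x| := by
      have := abs_sub (y - x) ((y + l) - (x + k))
      rw [show (y - x) - ((y + l) - (x + k)) = k - l by ring] at this
      linarith
    linarith
  rw [div_sub_div _ _ hA.ne' hB.ne', one_mul, mul_one, abs_div, abs_of_pos (mul_pos hA hB)]
  have hden : (x + k) * (y + l) ≤ ((N : ℝ) + 1) ^ 2 := by
    rw [sq]
    exact mul_le_mul (by linarith) (by linarith) hB.le (by positivity)
  calc 1 / ((N : ℝ) + 1) ^ 3 = 1 / ((N : ℝ) + 1) / ((N : ℝ) + 1) ^ 2 := by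
        rw [div_div]; congr 1; ring
    _ ≤ _ := div_le_div₀ (abs_nonneg _) hnum (mul_pos hA hB) hden

/-- The sequences with a given initial word. -/
def cylinder (w : List (Fin N)) : Set (ℕ → Fin N) := {a | pref w.length a = w}

lemma isOpen_cylinder (w : List (Fin N)) : IsOpen (cylinder w) := by
  have hc : Continuous fun (a : ℕ → Fin N) (i : Fin w.length) => a i := by fun_prop
  exact (isOpen_discrete {u : Fin w.length → Fin N | List.ofFn u = w}).preimage hc

lemma continuous_code : Continuous (code : (ℕ → Fin N) → ℝ) := by
  refine continuous_iff_continuousAt.mpr fun a => Metric.tendsto_nhds.mpr fun ε hε => ?_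
  obtain ⟨n, hn⟩ := exists_nat_one_div_lt hε
  have ha : a ∈ cylinder (pref (n + 1) a) := by simp [cylinder]
  filter_upwards [(isOpen_cylinder _).mem_nhds ha] with b hb
  have hb' : pref (n + 1) b = pref (n + 1) a := by simpa [cylinder] using hb
  have h1 := code_mem b (n + 1)
  rw [hb'] at h1
  refine lt_of_le_of_lt
    (abs_sub_le_of_mem_image h1 (code_mem a (n + 1)) n.succ_pos (by simp)) ?_
  push_cast
  exact hn

end Coding

/-! ## A measure on sequences and positivity of the Hausdorff measure -/

section Lower

variable {N : ℕ}

/-- The sequence that continues a word with zeros. -/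
def extend [NeZero N] (w : List (Fin N)) : ℕ → Fin N := fun n => w.getD n 0

lemma pref_extend_append [NeZero N] (u v : List (Fin N)) : pref u.length (extend (u ++ v)) = u := by
  refine List.ext_getElem (by simp) fun i h1 h2 => ?_
  simp [pref, extend, List.getElem?_append_left h2, List.getElem?_eq_getElem h2]

/-- The measure that gives the words of length `n` weights proportional to `q ^ (-σ)`. -/
noncomputable def wordMeasure (N : ℕ) [NeZero N] (σ : ℝ) (n : ℕ) : Measure (ℕ → Fin N) :=
  wordSum N n fun w =>
    ENNReal.ofReal ((cont w : ℝ) ^ (-σ) / partition N σ n) • Measure.dirac (extend w)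

lemma wordMeasure_apply [NeZero N] (σ : ℝ) (n : ℕ) {s : Set (ℕ → Fin N)} (hs : MeasurableSet s) :
    wordMeasure N σ n s = wordSum N n fun w =>
      ENNReal.ofReal ((cont w : ℝ) ^ (-σ) / partition N σ n) * s.indicator 1 (extend w) := by
  simp only [wordMeasure, wordSum]
  rw [Measure.finsetSum_apply]
  simp [Measure.dirac_apply' _ hs]

instance [NeZero N] (σ : ℝ) (n : ℕ) : IsProbabilityMeasure (wordMeasure N σ n) := by
  refine ⟨?_⟩
  rw [wordMeasure_apply σ n MeasurableSet.univ]
  simp only [wordSum, indicator_univ, Pi.one_apply, mul_one]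
  rw [← ENNReal.ofReal_sum_of_nonneg fun f _ =>
    div_nonneg (Real.rpow_nonneg (cont_pos' _).le _) (partition_pos σ n).le, ← Finset.sum_div]
  have : ∑ f : Fin n → Fin N, (cont (List.ofFn f) : ℝ) ^ (-σ) = partition N σ n := rfl
  rw [this, div_self (partition_pos σ n).ne', ENNReal.ofReal_one]

/-- Only the words `w ++ v` contribute. Their weights sum to at most `q_w ^ (-σ)` times a partition
function, and the normalizing denominator is at least 1. -/
lemma wordMeasure_cylinder_le [NeZero N] {σ : ℝ} (hσ : 0 ≤ σ)
    (hZ : ∀ n, 1 ≤ partition N σ n ∧ partition N σ n ≤ 2 ^ σ) (w : List (Fin N)) {n : ℕ}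
    (hn : w.length ≤ n) :
    wordMeasure N σ n (cylinder w) ≤ ENNReal.ofReal (2 ^ σ * (cont w : ℝ) ^ (-σ)) := by
  obtain ⟨j, rfl⟩ := Nat.exists_eq_add_of_le hn
  have hq : (0 : ℝ) ≤ (cont w : ℝ) ^ (-σ) := Real.rpow_nonneg (cont_pos' w).le _
  rw [wordMeasure_apply σ _ (isOpen_cylinder w).measurableSet, wordSum_add]
  simp only [wordSum]
  rw [Finset.sum_eq_single w.get]
  · rw [List.ofFn_get]
    calc _ ≤ ∑ v : Fin j → Fin N,
          ENNReal.ofReal ((cont w : ℝ) ^ (-σ) * (cont (List.ofFn v) : ℝ) ^ (-σ)) := by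
          refine Finset.sum_le_sum fun v _ => ?_
          refine (mul_le_of_le_one_right (zero_le) (indicator_le_self (cylinder w) 1 _)).trans
            (ENNReal.ofReal_le_ofReal ?_)
          refine (div_le_self (Real.rpow_nonneg (cont_pos' _).le _) (hZ _).1).trans ?_
          rw [← Real.mul_rpow (cont_pos' _).le (cont_pos' _).le]
          refine Real.rpow_le_rpow_of_nonpos (mul_pos (cont_pos' _) (cont_pos' _)) ?_ (by linarith)
          exact_mod_cast cont_mul_le _ _
      _ = ENNReal.ofReal ((cont w : ℝ) ^ (-σ) * partition N σ j) := by
          rw [partition, wordSum, Finset.mul_sum, ENNReal.ofReal_sum_of_nonneg]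
          exact fun v _ => mul_nonneg hq (Real.rpow_nonneg (cont_pos' _).le _)
      _ ≤ _ := by
          rw [mul_comm]
          exact ENNReal.ofReal_le_ofReal (mul_le_mul_of_nonneg_right (hZ j).2 hq)
  · intro u _ hu
    refine Finset.sum_eq_zero fun v _ => ?_
    rw [indicator_of_notMem, mul_zero]
    intro h
    have h1 := pref_extend_append (List.ofFn u) (List.ofFn v)
    rw [List.length_ofFn] at h1
    have h2 : pref w.length (extend (List.ofFn u ++ List.ofFn v)) = w := h
    rw [h1] at h2
    exact hu (List.ofFn_injective (h2.trans (List.ofFn_get w).symm))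
  · simp

/-- Probability measures on the compact sequence space form a compact space, so a limit along an
ultrafilter exists. Cylinders are open, which is what the bound needs to pass to the limit. -/
lemma exists_gibbs [NeZero N] {σ : ℝ} (hσ : 0 ≤ σ)
    (hZ : ∀ n, 1 ≤ partition N σ n ∧ partition N σ n ≤ 2 ^ σ) :
    ∃ μ : Measure (ℕ → Fin N), IsProbabilityMeasure μ ∧
      ∀ w, μ (cylinder w) ≤ ENNReal.ofReal (2 ^ σ * (cont w : ℝ) ^ (-σ)) := by
  let m : ℕ → ProbabilityMeasure (ℕ → Fin N) := fun n => ⟨wordMeasure N σ n, inferInstance⟩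
  let U : Ultrafilter (ProbabilityMeasure (ℕ → Fin N)) := (Filter.hyperfilter ℕ).map m
  have hU : Filter.Tendsto m (Filter.hyperfilter ℕ) (nhds U.lim) := U.le_nhds_lim
  refine ⟨U.lim, inferInstance, fun w => ?_⟩
  refine (ProbabilityMeasure.le_liminf_measure_open_of_tendsto hU (isOpen_cylinder w)).trans ?_
  refine (Filter.liminf_le_liminf ?_).trans (Filter.liminf_const _).le
  have : (Filter.hyperfilter ℕ : Filter ℕ) ≤ Filter.atTop := by
    rw [← Nat.cofinite_eq_atTop]
    exact Filter.hyperfilter_le_cofinite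
  exact this (by
    filter_upwards [Filter.eventually_ge_atTop w.length] with n hn
    exact wordMeasure_cylinder_le hσ hZ w hn)

/-- Let `w` be the longest common prefix of the sequences coded into `s`. They all lie in the
cylinder of `w`, and two of them part right after `w`, which forces the diameter of `s` to be at
least a constant times `q_w ^ (-2)`. -/
lemma measure_preimage_code_le {σ : ℝ} (hσ : 0 < σ) {μ : Measure (ℕ → Fin N)}
    (hμ : ∀ w, μ (cylinder w) ≤ ENNReal.ofReal (2 ^ σ * (cont w : ℝ) ^ (-σ))) (s : Set ℝ) :
    μ (code ⁻¹' s) ≤ ENNReal.ofReal (2 ^ σ * (4 * ((N : ℝ) + 1) ^ 3) ^ (σ / 2)) *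
      Metric.ediam s ^ (σ / 2) := by
  classical
  by_cases hex : ∃ n, ∃ a ∈ (code ⁻¹' s : Set (ℕ → Fin N)), ∃ b ∈ (code ⁻¹' s : Set (ℕ → Fin N)),
      a n ≠ b n
  · obtain ⟨a, ha, b, hb, hab⟩ := Nat.find_spec hex
    set n := Nat.find hex with hn
    have hagree : ∀ c ∈ code ⁻¹' s, pref n c = pref n a := by
      intro c hc
      refine congrArg List.ofFn (funext fun i => ?_)
      by_contra hne
      exact Nat.find_min hex i.2 ⟨c, hc, a, ha, hne⟩
    set w := pref n a with hw
    have hsub : code ⁻¹' s ⊆ cylinder w := fun c hc => by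
      simpa [cylinder, hw] using hagree c hc
    have hsep : 1 / ((N : ℝ) + 1) ^ 3 / (4 * (cont w : ℝ) ^ 2) ≤ |code a - code b| := by
      rw [code_eq_phi n a, code_eq_phi n b, hagree b hb]
      refine le_trans ?_ (le_abs_phi_sub w (code_mem_Icc _) (code_mem_Icc _))
      refine div_le_div_of_nonneg_right (le_abs_code_sub ?_) (by positivity)
      simpa [shift_iterate] using hab
    have hq := cont_pos' w
    have hbound : 1 / (cont w : ℝ) ^ 2 ≤ 4 * ((N : ℝ) + 1) ^ 3 * |code a - code b| := by
      have := mul_le_mul_of_nonneg_left hsep (by positivity : 0 ≤ 4 * ((N : ℝ) + 1) ^ 3)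
      refine le_trans (le_of_eq ?_) this
      field_simp
    calc μ (code ⁻¹' s) ≤ ENNReal.ofReal (2 ^ σ * (cont w : ℝ) ^ (-σ)) :=
          (measure_mono hsub).trans (hμ w)
      _ ≤ ENNReal.ofReal (2 ^ σ * (4 * ((N : ℝ) + 1) ^ 3) ^ (σ / 2) *
            |code a - code b| ^ (σ / 2)) := by
          refine ENNReal.ofReal_le_ofReal ?_
          rw [mul_assoc, ← Real.mul_rpow (by positivity) (abs_nonneg _), ← one_div_cont_sq_rpow]
          refine mul_le_mul_of_nonneg_left ?_ (by positivity)
          exact Real.rpow_le_rpow (by positivity) hbound (by positivity)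
      _ = ENNReal.ofReal (2 ^ σ * (4 * ((N : ℝ) + 1) ^ 3) ^ (σ / 2)) *
            edist (code a) (code b) ^ (σ / 2) := by
          rw [ENNReal.ofReal_mul (by positivity), edist_dist, Real.dist_eq,
            ENNReal.ofReal_rpow_of_nonneg (abs_nonneg _) (by positivity)]
      _ ≤ _ := by
          gcongr
          exact Metric.edist_le_ediam_of_mem ha hb
  -- Here the preimage has at most one point, and points are null because cylinder measures tend to
  -- `0` for `σ > 0`.
  · have hzero : μ (code ⁻¹' s) = 0 := by
      rcases (code ⁻¹' s : Set (ℕ → Fin N)).eq_empty_or_nonempty with he | ⟨a, ha⟩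
      · simp [he]
      have hle : ∀ n : ℕ, 0 < n → μ (code ⁻¹' s) ≤ ENNReal.ofReal (2 ^ σ * (n : ℝ) ^ (-σ)) := by
        intro n hn
        have hsub : code ⁻¹' s ⊆ cylinder (pref n a) := fun c hc => by
          push Not at hex
          have : c = a := funext fun n => hex n c hc a ha
          simp [cylinder, this]
        refine ((measure_mono hsub).trans (hμ _)).trans (ENNReal.ofReal_le_ofReal ?_)
        refine mul_le_mul_of_nonneg_left ?_ (by positivity)
        refine Real.rpow_le_rpow_of_nonpos (by exact_mod_cast hn) ?_ (by linarith)
        have := length_le_cont (pref n a)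
        rw [length_pref] at this
        exact_mod_cast this
      have hlim : Filter.Tendsto (fun n : ℕ => ENNReal.ofReal (2 ^ σ * (n : ℝ) ^ (-σ)))
          Filter.atTop (nhds 0) := by
        rw [← ENNReal.ofReal_zero]
        refine ENNReal.tendsto_ofReal ?_
        have := ((tendsto_rpow_neg_atTop hσ).comp tendsto_natCast_atTop_atTop).const_mul
          ((2 : ℝ) ^ σ)
        simpa using this
      exact le_antisymm (ge_of_tendsto hlim ((Filter.eventually_gt_atTop 0).mono hle)) (zero_le)
    rw [hzero]
    exact zero_le

lemma hausdorffMeasure_cantorE_pos [NeZero N] {σ : ℝ} (hσ : 0 < σ)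
    (hZ : ∀ n, 1 ≤ partition N σ n ∧ partition N σ n ≤ 2 ^ σ) :
    0 < Measure.hausdorffMeasure (σ / 2) (cantorE N) := by
  obtain ⟨μ, hμ, hcyl⟩ := exists_gibbs hσ.le hZ
  set C := ENNReal.ofReal (2 ^ σ * (4 * ((N : ℝ) + 1) ^ 3) ^ (σ / 2)) with hC
  have hC0 : C ≠ 0 := (ENNReal.ofReal_pos.mpr (by positivity)).ne'
  have hCt : C ≠ ⊤ := ENNReal.ofReal_ne_top
  have hle : C⁻¹ • μ.map code ≤ Measure.hausdorffMeasure (σ / 2) := by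
    refine Measure.le_hausdorffMeasure (σ / 2) _ 1 one_pos fun s _ => ?_
    -- The set `s` is arbitrary; its closure is measurable and has the same diameter.
    calc (C⁻¹ • μ.map code) s ≤ (C⁻¹ • μ.map code) (closure s) := measure_mono subset_closure
      _ = C⁻¹ * μ (code ⁻¹' closure s) := by
          rw [Measure.smul_apply, Measure.map_apply continuous_code.measurable
            isClosed_closure.measurableSet, smul_eq_mul]
      _ ≤ C⁻¹ * (C * Metric.ediam (closure s) ^ (σ / 2)) := by
          gcongr
          exact measure_preimage_code_le hσ hcyl _
      _ = Metric.ediam s ^ (σ / 2) := by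
          rw [← mul_assoc, ENNReal.inv_mul_cancel hC0 hCt, one_mul, Metric.ediam_closure]
  refine lt_of_lt_of_le ?_ (hle _)
  rw [Measure.smul_apply, smul_eq_mul]
  refine ENNReal.mul_pos (ENNReal.inv_ne_zero.mpr hCt) (ne_of_gt (lt_of_lt_of_le one_pos ?_))
  refine le_trans (le_of_eq ?_) (Measure.le_map_apply continuous_code.aemeasurable _)
  rw [show code ⁻¹' cantorE N = univ from eq_univ_of_forall code_mem_cantorE, measure_univ]

lemma dimE_eq [NeZero N] {σ : ℝ} (hσ : 0 < σ)
    (hZ : ∀ n, 1 ≤ partition N σ n ∧ partition N σ n ≤ 2 ^ σ) : dimE N = σ / 2 := by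
  have h := dimH_of_hausdorffMeasure_ne_zero_ne_top (d := Real.toNNReal (σ / 2)) (s := cantorE N)
  rw [Real.coe_toNNReal _ (by positivity)] at h
  rw [dimE, h (hausdorffMeasure_cantorE_pos hσ hZ).ne'
    (hausdorffMeasure_cantorE_lt_top hσ fun n => (hZ n).2).ne]
  simp
  positivity

end Lower

/-! ## Transitivity of the semigroup with bounded partial quotients -/

section Transitivity

variable {N : ℕ} {P : Type*} [MulAction PGL2Z P]

/-- The action of a word. -/
noncomputable def actWord : List (Fin N) → P → P
  | [], t => t
  | i :: w, t => act (redGen ((i + 1 : ℕ) : ℤ)) (actWord w t)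

/-- The matrix `(1 1; 0 1)` as an element of `GL(2,ℤ)`. -/
noncomputable def unipotent : GL (Fin 2) ℤ :=
  Matrix.GeneralLinearGroup.mk'' !![1, 1; 0, 1] (by simp [Matrix.det_fin_two])

lemma redGen_mul_unipotent (k : ℤ) : redGen k * unipotent = redGen (k + 1) := by
  refine Units.ext ?_
  have : (!![0, 1; 1, k] : Matrix (Fin 2) (Fin 2) ℤ) * !![1, 1; 0, 1] = !![0, 1; 1, k + 1] := by
    simp [add_comm]
  exact this

/-- The quotient `(redGen 1)⁻¹ * redGen 2` is the unipotent matrix that raises `k` by one. -/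
lemma redGen_mem {K : Subgroup (GL (Fin 2) ℤ)} (h1 : redGen 1 ∈ K) (h2 : redGen 2 ∈ K) {k : ℤ}
    (hk : 1 ≤ k) : redGen k ∈ K := by
  have hU : unipotent ∈ K := by
    have : unipotent = (redGen 1)⁻¹ * redGen 2 := by
      rw [eq_inv_mul_iff_mul_eq, redGen_mul_unipotent]
      norm_num
    rw [this]
    exact K.mul_mem (K.inv_mem h1) h2
  induction k, hk using Int.leInduction with
  | base => exact h1
  | succ k _ ih =>
    rw [← redGen_mul_unipotent]
    exact K.mul_mem ih hU

-- The set `R` reached from `t` is finite and mapped into itself by each letter, hence preserved by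
-- it. So the stabilizer of `R` contains the letters 1 and 2, and with them all of `Red`.
open scoped Pointwise in
lemma exists_actWord_eq [Finite P] (hN : 2 ≤ N) (hP : RedTransitive P) (t t' : P) :
    ∃ w : List (Fin N), actWord w t = t' := by
  set R : Set P := range fun w : List (Fin N) => actWord w t with hR
  set K : Subgroup (GL (Fin 2) ℤ) :=
    (MulAction.stabilizer PGL2Z R).comap (QuotientGroup.mk' _) with hK
  have hmem : ∀ i : Fin N, redGen ((i + 1 : ℕ) : ℤ) ∈ K := by
    intro i
    rw [hK, Subgroup.mem_comap, MulAction.mem_stabilizer_set_iff_smul_set_subset R.toFinite]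
    rintro _ ⟨_, ⟨w, rfl⟩, rfl⟩
    exact ⟨i :: w, rfl⟩
  have hgen : ∀ k : ℤ, 1 ≤ k → redGen k ∈ K := fun k hk =>
    redGen_mem (hmem ⟨0, by omega⟩) (hmem ⟨1, by omega⟩) hk
  have ht' : t' ∈ (fun g => act g t) '' Red := by
    rw [hP t]
    trivial
  obtain ⟨g, hg, rfl⟩ := ht'
  have hgK : g ∈ K := by
    simp only [Red, mem_iUnion] at hg
    obtain ⟨n, -, a, ha, rfl⟩ := hg
    refine Subgroup.list_prod_mem _ fun x hx => ?_
    obtain ⟨i, rfl⟩ := (List.mem_ofFn' _ _).mp hx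
    exact hgen _ (ha i)
  rw [hK, Subgroup.mem_comap, MulAction.mem_stabilizer_iff] at hgK
  have htR : t ∈ R := ⟨[], rfl⟩
  have : act g t ∈ R := by
    rw [← hgK]
    exact smul_mem_smul_set htR
  exact this

end Transitivity

/-! ## Uniqueness -/

section Uniqueness

variable {N : ℕ} {P : Type*} [MulAction PGL2Z P]

/-- The action of the letter `i` on `ℝ × P`. -/
noncomputable def step (i : Fin N) (p : ℝ × P) : ℝ × P :=
  (1 / (p.1 + ((i + 1 : ℕ) : ℝ)), act (redGen ((i + 1 : ℕ) : ℤ)) p.2)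

lemma step_injOn (i : Fin N) : InjOn (step (P := P) i) {p | p.1 ∈ Icc (0 : ℝ) 1} := by
  rintro ⟨x, t⟩ hx ⟨y, u⟩ hy h
  obtain ⟨h1, h2⟩ := Prod.mk.inj h
  refine Prod.ext ?_ (MulAction.injective _ h2)
  rw [one_div, one_div, inv_inj] at h1
  exact add_right_cancel h1

/-- A nonempty set that is stable under two different letters is infinite. -/
lemma infinite_of_stable (hN : 2 ≤ N) {S : Set (ℝ × P)} (hne : S.Nonempty)
    (hsub : S ⊆ {p | p.1 ∈ Icc (0 : ℝ) 1}) (hS : ∀ i : Fin N, MapsTo (step i) S S) :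
    S.Infinite := by
  intro hfin
  have := hfin.to_subtype
  have hsurj : ∀ i : Fin N, ∀ p ∈ S, ∃ r ∈ S, step i r = p := by
    intro i p hp
    have hinj : Function.Injective ((hS i).restrict _ _ _) :=
      (hS i).restrict_inj.mpr ((step_injOn i).mono hsub)
    obtain ⟨r, hr⟩ := Finite.surjective_of_injective hinj ⟨p, hp⟩
    exact ⟨r, r.2, congrArg Subtype.val hr⟩
  -- Partial quotient 1 maps `[0, 1]` into `[1/2, 1]`, partial quotient 2 into `[1/3, 1/2]`, and a
  -- finite `S` is the image of itself under both. But `1/2` is sent to `2/3` by partial quotient 1.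
  have hhalf : ∀ p ∈ S, p.1 = 1 / 2 := by
    intro p hp
    obtain ⟨r, hr, h1⟩ := hsurj ⟨0, by omega⟩ p hp
    obtain ⟨u, hu, h2⟩ := hsurj ⟨1, by omega⟩ p hp
    have hr' := hsub hr
    have hu' := hsub hu
    have e1 : p.1 = 1 / (r.1 + 1) := by rw [← h1]; simp [step]
    have e2 : p.1 = 1 / (u.1 + 2) := by rw [← h2]; norm_num [step]
    refine le_antisymm ?_ ?_
    · rw [e2]
      exact one_div_le_one_div_of_le two_pos (by linarith [hu'.1])
    · rw [e1]
      exact one_div_le_one_div_of_le (by linarith [hr'.1]) (by linarith [hr'.2])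
  obtain ⟨p, hp⟩ := hne
  have h1 := hhalf p hp
  have h2 := hhalf _ (hS ⟨0, by omega⟩ hp)
  simp only [step, h1] at h2
  norm_num at h2

/-- The identity theorem on the closed disc. -/
lemma eqOn_of_infinite {f g : C(closedDisc, ℂ)} (hf : DifferentiableOn ℂ (onPlane f) openDisc)
    (hg : DifferentiableOn ℂ (onPlane g) openDisc)
    (hinf : {x : ℝ | x ∈ Icc (0 : ℝ) 1 ∧ onPlane f x = onPlane g x}.Infinite) :
    EqOn (onPlane f) (onPlane g) closedDisc := by
  have hopen : IsOpen openDisc := Metric.isOpen_ball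
  set T := {x : ℝ | x ∈ Icc (0 : ℝ) 1 ∧ onPlane f x = onPlane g x}
  have hcomp : IsCompact (((↑) : ℝ → ℂ) '' Icc (0 : ℝ) 1) :=
    isCompact_Icc.image Complex.continuous_ofReal
  obtain ⟨_, ⟨x, hx, rfl⟩, hacc⟩ :=
    (hinf.image Complex.ofReal_injective.injOn).exists_accPt_of_subset_isCompact hcomp
      (image_mono fun x hx => hx.1)
  have hfreq : ∃ᶠ z in nhdsWithin (x : ℂ) {(x : ℂ)}ᶜ, onPlane f z = onPlane g z := by
    refine (accPt_iff_frequently_nhdsNE.mp hacc).mono ?_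
    rintro _ ⟨y, hy, rfl⟩
    exact hy.2
  have heq : EqOn (onPlane f) (onPlane g) openDisc :=
    (hf.analyticOnNhd hopen).eqOn_of_preconnected_of_frequently_eq (hg.analyticOnNhd hopen)
      (convex_ball _ _).isPreconnected (ofReal_mem_openDisc hx) hfreq
  refine heq.of_subset_closure (continuousOn_onPlane f) (continuousOn_onPlane g)
    openDisc_subset ?_
  rw [openDisc, closure_ball _ (by norm_num), closedDisc]

lemma evalAt_eq_of_infinite {Q : Type*} {f : V Q} {h : V Unit} {c : ℝ} {t : Q}
    (hinf : {x : ℝ | x ∈ Icc (0 : ℝ) 1 ∧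
      (evalAt f (x : ℂ) t).re = c * (evalAt h (x : ℂ) ()).re}.Infinite) :
    ∀ z ∈ closedDisc, evalAt f z t = c * evalAt h z () := by
  intro z hz
  rw [← evalAt_smul]
  refine eqOn_of_infinite (f := f.1 t) (g := (c • h).1 ()) (f.2 t).1 ((c • h).2 ()).1
    (hinf.mono ?_) hz
  rintro x ⟨hx, hxe⟩
  refine ⟨hx, ?_⟩
  show evalAt f x t = evalAt (c • h) x ()
  rw [evalAt_smul, ← ofReal_evalAt_re f hx, hxe, ← ofReal_evalAt_re h hx]
  push_cast
  simp

/-- Every fixed function on `P` is a multiple of a positive fixed function on the base. -/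
lemma fixed_eq_smul [Finite P] [Nonempty P] (hN : 2 ≤ N)
    (htrans : ∀ t t' : P, ∃ w : List (Fin N), actWord w t = t') {σ : ℝ} {h : V Unit}
    (hh : truncGK Unit σ N h = h) (hpos : ∀ x ∈ Icc (0 : ℝ) 1, 0 < (evalAt h (x : ℂ) ()).re)
    {f : V P} (hf : truncGK P σ N f = f) :
    ∃ c : ℝ, ∀ z ∈ closedDisc, ∀ t, evalAt f z t = c * evalAt h z () := by
  set F : P → ℝ → ℝ := fun t x => (evalAt f (x : ℂ) t).re with hF
  set H : ℝ → ℝ := fun x => (evalAt h (x : ℂ) ()).re with hH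
  have hFeq : ∀ t, ∀ x ∈ Icc (0 : ℝ) 1, F t x = ∑ i : Fin N, (x + ((i + 1 : ℕ) : ℝ)) ^ (-σ) *
      F (act (redGen ((i + 1 : ℕ) : ℤ)) t) (1 / (x + ((i + 1 : ℕ) : ℝ))) := by
    intro t x hx
    rw [hF, ← truncSum_ofReal_re σ f hx t, ← evalAt_truncGK σ f (ofReal_mem_closedDisc hx), hf]
  have hHeq : ∀ x ∈ Icc (0 : ℝ) 1, H x = ∑ i : Fin N, (x + ((i + 1 : ℕ) : ℝ)) ^ (-σ) *
      H (1 / (x + ((i + 1 : ℕ) : ℝ))) := by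
    intro x hx
    rw [hH]
    refine Eq.trans ?_ (truncSum_ofReal_re σ h hx ())
    rw [← evalAt_truncGK σ h (ofReal_mem_closedDisc hx), hh]
  have hmax : ∀ t, ∃ x ∈ Icc (0 : ℝ) 1, IsMaxOn (fun x => F t x / H x) (Icc 0 1) x := fun t =>
    isCompact_Icc.exists_isMaxOn (nonempty_Icc.mpr zero_le_one)
      ((continuousOn_evalAt_re f t).div (continuousOn_evalAt_re h ()) fun x hx => (hpos x hx).ne')
  choose y hy hymax using hmax
  obtain ⟨t₀, ht₀⟩ := Finite.exists_max fun t => F t (y t) / H (y t)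
  set M := F t₀ (y t₀) / H (y t₀) with hM
  have hle : ∀ t, ∀ x ∈ Icc (0 : ℝ) 1, F t x ≤ M * H x := fun t x hx =>
    (div_le_iff₀ (hpos x hx)).mp ((hymax t hx).trans (ht₀ t))
  -- At a point of `S` the equations for `F` and `M * H` agree; since `F ≤ M * H` and the weights
  -- are positive, they agree term by term.
  set S : Set (ℝ × P) := {p | p.1 ∈ Icc (0 : ℝ) 1 ∧ F p.2 p.1 = M * H p.1} with hS
  have hstable : ∀ i : Fin N, MapsTo (step i) S S := by
    rintro i ⟨x, t⟩ ⟨hx, hxe⟩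
    refine ⟨inv_add_mem_Icc hx i, ?_⟩
    have hx0 : 0 ≤ x := hx.1
    have hsum : ∑ j : Fin N, (x + ((j + 1 : ℕ) : ℝ)) ^ (-σ) *
        (M * H (1 / (x + ((j + 1 : ℕ) : ℝ))) -
          F (act (redGen ((j + 1 : ℕ) : ℤ)) t) (1 / (x + ((j + 1 : ℕ) : ℝ)))) = 0 := by
      simp only [mul_sub, Finset.sum_sub_distrib]
      rw [← hFeq t x hx]
      simp only [mul_left_comm _ M]
      rw [← Finset.mul_sum, ← hHeq x hx]
      exact sub_eq_zero.mpr hxe.symm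
    have hterm := (Finset.sum_eq_zero_iff_of_nonneg fun (j : Fin N) _ => mul_nonneg
      (Real.rpow_nonneg (add_nonneg hx0 (Nat.cast_nonneg _)) _)
      (sub_nonneg.mpr (hle _ _ (inv_add_mem_Icc hx j)))).mp hsum i (Finset.mem_univ i)
    have hw : (x + ((i + 1 : ℕ) : ℝ)) ^ (-σ) ≠ 0 := (Real.rpow_pos_of_pos (by positivity) _).ne'
    exact (sub_eq_zero.mp ((mul_eq_zero.mp hterm).resolve_left hw)).symm
  have hinf : S.Infinite := infinite_of_stable hN
    ⟨(y t₀, t₀), hy t₀, (div_mul_cancel₀ _ (hpos _ (hy t₀)).ne').symm⟩ (fun p hp => hp.1) hstable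
  have hword : ∀ (w : List (Fin N)) (x : ℝ) (t : P), (x, t) ∈ S → (phi w x, actWord w t) ∈ S := by
    intro w x t hxt
    induction w with
    | nil => simpa [actWord] using hxt
    | cons i w ih =>
      rw [phi_cons _ _ (den_pos w hxt.1).ne']
      exact hstable i ih
  obtain ⟨t₁, ht₁⟩ : ∃ t, {x | (x, t) ∈ S}.Infinite := by
    by_contra! hcon
    refine hinf ((finite_iUnion fun t => (hcon t).image fun x => (x, t)).subset ?_)
    rintro ⟨x, t⟩ hxt
    exact mem_iUnion.mpr ⟨t, x, hxt, rfl⟩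
  have hall := evalAt_eq_of_infinite (f := f) (h := h) (c := M) (t := t₁) ht₁
  refine ⟨M, fun z hz t => evalAt_eq_of_infinite ?_ z hz⟩
  obtain ⟨w, hw⟩ := htrans t₁ t
  -- The whole interval over `t₁` lies in `S`; a word leading from `t₁` to `t` carries it
  -- injectively into `S` over `t`.
  refine ((Icc_infinite (zero_lt_one (α := ℝ))).image (phi_injOn w)).mono ?_
  rintro _ ⟨x, hx, rfl⟩
  have hxS : (x, t₁) ∈ S := by
    refine ⟨hx, ?_⟩
    simp only [hF, hH, hall x (ofReal_mem_closedDisc hx), Complex.re_ofReal_mul]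
  have := hword w x t₁ hxS
  rw [hw] at this
  exact this

end Uniqueness

/-! ## Normalization -/

section Normalization

variable {N : ℕ}

/-- The function on `P` that is `c` times a given function on the base on every sheet. -/
noncomputable def liftV (P : Type*) (h : V Unit) (c : ℝ) : V P :=
  ⟨fun _ => (c • h).1 (), fun _ => (c • h).2 ()⟩

lemma evalAt_liftV {P : Type*} (h : V Unit) (c : ℝ) (z : ℂ) (t : P) :
    evalAt (liftV P h c) z t = c * evalAt h z () :=
  evalAt_smul c h z ()

/-- The lifted function does not depend on the sheet, so the action on the sheets plays no role. -/
lemma truncGK_liftV {P : Type*} [MulAction PGL2Z P] {σ : ℝ} {h : V Unit}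
    (hh : truncGK Unit σ N h = h) (c : ℝ) : truncGK P σ N (liftV P h c) = liftV P h c := by
  refine V_ext fun z hz t => ?_
  rw [evalAt_truncGK σ _ hz, evalAt_liftV]
  conv_rhs => rw [← hh, evalAt_truncGK σ _ hz]
  simp only [truncSum, evalAt_liftV, Finset.mul_sum]
  refine Finset.sum_congr rfl fun k _ => ?_
  rw [mul_left_comm]

/-- The integral of a positive function over `E_N` is positive. -/
lemma integral_pos {d : ℝ} (h0 : 0 < Measure.hausdorffMeasure d (cantorE N))
    (htop : Measure.hausdorffMeasure d (cantorE N) < ⊤) {g : ℝ → ℝ}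
    (hg : ContinuousOn g (Icc 0 1)) (hpos : ∀ x ∈ Icc (0 : ℝ) 1, 0 < g x) :
    0 < ∫ x in cantorE N, g x ∂(Measure.hausdorffMeasure d) := by
  set μ : Measure ℝ := (Measure.hausdorffMeasure d).restrict (cantorE N) with hμ
  have hfin : IsFiniteMeasure μ := ⟨by rwa [hμ, Measure.restrict_apply_univ]⟩
  -- Only the measurable set `[0, 1]` containing `E_N` is used, so no measurability of `E_N` is
  -- involved.
  have hsub : cantorE N ⊆ Icc 0 1 := fun x hx => hx.1
  have hae : ∀ᵐ x ∂μ, x ∈ Icc (0 : ℝ) 1 :=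
    ae_mono (Measure.restrict_mono hsub le_rfl) (ae_restrict_mem measurableSet_Icc)
  have hmeas : AEStronglyMeasurable g μ :=
    (hg.aestronglyMeasurable measurableSet_Icc).mono_measure (Measure.restrict_mono hsub le_rfl)
  obtain ⟨C, hC⟩ := isCompact_Icc.exists_bound_of_continuousOn hg
  have hint : Integrable g μ := Integrable.of_bound hmeas C (hae.mono hC)
  refine (integral_pos_iff_support_of_nonneg_ae (hae.mono fun x hx => (hpos x hx).le) hint).mpr ?_
  have : μ (Function.support g) = μ univ := measure_congr
    (Filter.eventuallyEq_set.mpr (hae.mono fun x hx => by simp [(hpos x hx).ne']))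
  rw [this, hμ, Measure.restrict_apply_univ]
  exact h0

/-- Used both for one sheet and for `P`, with the same `h`: the two normalizing constants differ
exactly by the factor `|P|`. -/
lemma isUniqueNormalizedEigenfunction_liftV {P : Type*} [MulAction PGL2Z P] [Fintype P]
    [Nonempty P] (hN : 2 ≤ N) (htrans : ∀ t t' : P, ∃ w : List (Fin N), actWord w t = t')
    {h : V Unit} (hh : truncGK Unit (2 * dimE N) N h = h)
    (hpos : ∀ x ∈ Icc (0 : ℝ) 1, 0 < (evalAt h (x : ℂ) ()).re)
    (hI : 0 < ∫ x in cantorE N, (evalAt h (x : ℂ) ()).re ∂(Measure.hausdorffMeasure (dimE N))) :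
    IsUniqueNormalizedEigenfunction N (liftV P h ((Fintype.card P : ℝ) *
      ∫ x in cantorE N, (evalAt h (x : ℂ) ()).re ∂(Measure.hausdorffMeasure (dimE N)))⁻¹) := by
  set I := ∫ x in cantorE N, (evalAt h (x : ℂ) ()).re ∂(Measure.hausdorffMeasure (dimE N)) with hIdef
  have hcard : (0 : ℝ) < Fintype.card P := by exact_mod_cast Fintype.card_pos
  set c := ((Fintype.card P : ℝ) * I)⁻¹ with hc
  have hc0 : c ≠ 0 := by positivity
  have hfix := truncGK_liftV (P := P) hh c
  have hmem : liftV P h c ∈ (truncGK P (2 * dimE N) N).eigenspace 1 := by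
    rw [Module.End.mem_eigenspace_iff, one_smul, hfix]
  refine ⟨⟨hmem, fun h0 => ?_⟩, le_antisymm (fun f hf => ?_) ?_, ?_⟩
  · obtain ⟨t⟩ := ‹Nonempty P›
    have h1 := evalAt_liftV h c ((0 : ℝ) : ℂ) t
    have h2 := hpos 0 (left_mem_Icc.mpr zero_le_one)
    rw [h0, ← zero_smul ℝ (0 : V P), evalAt_smul, Complex.ofReal_zero, zero_mul] at h1
    rcases mul_eq_zero.mp h1.symm with h3 | h3
    · exact hc0 (Complex.ofReal_eq_zero.mp h3)
    · rw [Complex.ofReal_zero, h3] at h2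
      simp at h2
  · rw [Module.End.mem_eigenspace_iff, one_smul] at hf
    obtain ⟨a, ha⟩ := fixed_eq_smul hN htrans hh hpos hf
    refine Submodule.mem_span_singleton.mpr ⟨a / c, V_ext fun z hz t => ?_⟩
    rw [evalAt_smul, evalAt_liftV, ha z hz t, ← mul_assoc, ← Complex.ofReal_mul,
      div_mul_cancel₀ _ hc0]
  · exact (Submodule.span_singleton_le_iff_mem _ _).mpr hmem
  · simp only [mass, evalAt_liftV, Complex.re_ofReal_mul, integral_const_mul]
    rw [← hIdef, Finset.sum_const, Finset.card_univ, nsmul_eq_mul, ← mul_assoc,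
      mul_right_comm, hc]
    exact mul_inv_cancel₀ (by positivity)

end Normalization

end GaussKuzmin

/-! ### Assembly of the proof. -/

theorem proposition6p1 :
    ∃ N₀ : ℕ, ∀ N : ℕ, N₀ ≤ N →
      ∃ fN : GaussKuzmin.V Unit, GaussKuzmin.IsUniqueNormalizedEigenfunction N fN ∧
        ∀ (G : Subgroup GaussKuzmin.PGL2Z) [G.FiniteIndex] [Fintype (GaussKuzmin.PGL2Z ⧸ G)],
          GaussKuzmin.RedTransitive (GaussKuzmin.PGL2Z ⧸ G) →
            ∃ F : GaussKuzmin.V (GaussKuzmin.PGL2Z ⧸ G),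
              GaussKuzmin.IsUniqueNormalizedEigenfunction N F ∧
                ∀ z ∈ GaussKuzmin.closedDisc, ∀ t : GaussKuzmin.PGL2Z ⧸ G,
                  GaussKuzmin.evalAt F z t =
                    GaussKuzmin.evalAt fN z () / (Nat.card (GaussKuzmin.PGL2Z ⧸ G) : ℂ) := by
  open GaussKuzmin in
  -- Two letters suffice for a positive critical exponent, for infinite stable sets and for
  -- generating all the reduced matrices.
  refine ⟨2, fun N hN => ?_⟩
  have : NeZero N := ⟨by omega⟩
  obtain ⟨σ, hσ, hZ⟩ := exists_critical hN
  have hdim : dimE N = σ / 2 := dimE_eq hσ hZ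
  have h2 : 2 * dimE N = σ := by rw [hdim]; ring
  obtain ⟨h, hh, hpos⟩ := exists_fixed hσ.le hZ
  rw [← h2] at hh
  have hI := integral_pos (d := dimE N) (by rw [hdim]; exact hausdorffMeasure_cantorE_pos hσ hZ)
    (by rw [hdim]; exact hausdorffMeasure_cantorE_lt_top hσ fun n => (hZ n).2)
    (continuousOn_evalAt_re h ()) hpos
  refine ⟨_, isUniqueNormalizedEigenfunction_liftV (P := Unit) hN (fun t t' => ⟨[], rfl⟩) hh hpos hI,
    fun G _ _ hG => ⟨_, isUniqueNormalizedEigenfunction_liftV hN (exists_actWord_eq hN hG) hh hpos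
      hI, fun z _ t => ?_⟩⟩
  rw [evalAt_liftV, evalAt_liftV, Nat.card_eq_fintype_card]
  simp only [Fintype.card_unit, Nat.cast_one, one_mul, mul_inv, Complex.ofReal_mul,
    Complex.ofReal_inv, Complex.ofReal_natCast]
  ring
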